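/- **Setting.** Let $0<T<\infty$, let $(\Omega,\mathcal F,(\mathcal F_t)_{t\in[0,T]},\mathbb P)$ be a filtered probability space satisfying the usual conditions, $\mathbb E_\sigma=\mathbb E[\,\cdot\,|\mathcal F_\sigma]$ (with values in $[0,\infty]$ for non-negative random variables), and let $V=(V_t)_{t\in[0,T]}$ be a process with values in a normed space. Write $\delta V_{s,t}=V_t-V_s$, $\Delta V_t=V_t-V_{t-}$ and $V_{0-}=V_0$. For $F\colon\{0\le s\le t\le T\}\to[0,\infty]$ and $p\in[1,\infty)$ let $\|F\|_{p,[s,t]}=\big(\sup_{\mathcal P}\sum_{[u,v]\in\mathcal P}F_{u,v}^p\big)^{1/p}$, the supremum being over all partitions $\mathcal P$ of $[s,t]$ ($=0$ if $s=t$), and define $\|F\|_{p,[s,t)}$ and $\|F\|_{p,(s,t)}$ as the increasing limits of $\|F\|_{p,[s,v]}$ as $v\uparrow t$ and of $\|F\|_{p,[u,v]}$ as $u\downarrow s$, $v\uparrow t$ (both $=0$ if $s=t$). * With $\rho_{s,t}(V)=\sup_{s\le\sigma\le\tau\le t}\big\|\mathbb E_\sigma[|V_\tau-V_{\sigma-}|]\big\|_{L^\infty}$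 (supremum over stopping times $\sigma,\tau$), put $\|V\|_{\mathrm{BMO}^{p\text{-var}},I}=\|\rho(V)\|_{p,I}$; $V\in\mathrm{BMO}^{p\text{-var}}$ means that $V$ is adapted, almost surely càdlàg, and $\|V\|_{\mathrm{BMO}^{p\text{-var}},[0,T]}<\infty$. * For $q\in[1,\infty)$, $\|V\|_{p,q,\infty,I}$ is the $p$-variation over $I$ of $(s,t)\mapsto\big\|\mathbb E_s[|\delta V_{s,t}|^q]\big\|_{L^\infty}^{1/q}$; $V\in V^pL^{q,\infty}$ means that $V$ is almost surely càdlàg, $V_0\in L^q$ and $\|V\|_{p,q,\infty,[0,T]}<\infty$. * $\Gamma_{s,t}=\sup_{u\in[s,t]}|\Delta V_u|$, and $\|\Gamma\|_{p,\infty,I}$ is the $p$-variation over $I$ of $(s,t)\mapsto\|\Gamma_{s,t}\|_{L^\infty}$. * A control is a function $w\colon\{0\le s\le t\le T\}\to[0,\infty)$ with $w(s,u)+w(u,t)\le w(s,t)$ for $s\le u\le t$. It is regular from the inside if $w(s+,t)=w(s,t)=w(s,t-)$ for all $s\le t$ (where $w(t+,t)=w(t,t-)=0$) and $\lim_{t\downarrow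 s}w(s,t)=0$ for all $s<T$. For $\alpha>0$ let $t_0=s$, $t_i=\inf\{u>t_{i-1}: w(t_{i-1},u)\ge\alpha\}\wedge t$ for $i\ge1$, and $N_{\alpha,[s,t]}(w)=\sup\{n\ge0: t_n<t\}$ (with $\sup\emptyset=0$). **Theorem.** Let $p\in[1,\infty)$, $\alpha>0$ and $\lambda>0$. There is a constant $C>0$, depending only on $p,\alpha,\lambda$, such that the following hold for all $T$, all filtered probability spaces and all processes $V$ as above. 1. If $V\in\mathrm{BMO}^{p\text{-var}}$, then $w(s,t)=\|V\|^p_{\mathrm{BMO}^{p\text{-var}},(s,t)}$ is a control which is regular from the inside, and for every $r\in[0,T]$ the quantities $N_{\alpha,[r,T]}(w)$ and $\sup_{t\in(r,T]}\|\Delta V_t\|_{L^\infty}$ are finite and $$\Big\|\mathbb E_r\Big[\exp\Big(\lambda\sup_{t\in[r,T]}|\delta V_{r,t}|\Big)\Big]\Big\|_{L^\infty}\le\exp\Big(C\big(N_{\alpha,[r,T]}(w)+1\big)\Big(1+\sup_{t\in(r,T]}\|\Delta V_t\|_{L^\infty}\Big)\Big).$$ 2. If $q\in[1,\infty)$ and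 $V$ is adapted with $V\in V^pL^{q,\infty}$ and $\|\Gamma\|_{p,\infty,[0,T]}<\infty$, then the same conclusion, with the same $C$ (in particular not depending on $q$), holds for $w(s,t)=\|V\|^p_{p,1,\infty,[s,t)}+\|\Gamma\|^p_{p,\infty,(s,t)}$. 3. If $q\in[1,\infty)$ and $V$ is adapted and almost surely càdlàg with $V_0\in L^q$, then $V\in\mathrm{BMO}^{p\text{-var}}$ if and only if $V\in V^pL^{q,\infty}$ and $\|\Gamma\|_{p,\infty,[0,T]}<\infty$. -/

import Mathlib

open MeasureTheory Filter Topology Set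
open scoped ENNReal

noncomputable section

namespace JohnNirenberg

universe u v

/-- The time set `[0,T]`. -/
abbrev TimeSet (T : ℝ) : Type := Set.Icc (0 : ℝ) T

/-- The initial time `0` of `[0,T]`. -/
def start {T : ℝ} (hT : 0 < T) : TimeSet T := ⟨0, le_rfl, hT.le⟩

/-- The final time `T` of `[0,T]`. -/
def finish {T : ℝ} (hT : 0 < T) : TimeSet T := ⟨T, hT.le, le_rfl⟩

/-! ### Deterministic notions: controls, variation norms, greedy times -/

section Deterministic

variable {T : ℝ}

/-- A control: a finite superadditive function of the pairs `s ≤ t`.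
Values `w s t` with `t < s` play no role. -/
structure IsControl (w : TimeSet T → TimeSet T → ℝ≥0∞) : Prop where
  finite : ∀ s t, s ≤ t → w s t ≠ ∞
  superadditive : ∀ s u t, s ≤ u → u ≤ t → w s u + w u t ≤ w s t

/-- A control which is regular from the inside: `w(s+,t) = w(s,t) = w(s,t-)`, and
`w(s,t) → 0` as `t ↓ s`. (For `s = t` the first condition holds for every control,
as `w(t,t) = 0`.) -/
structure IsRegularControl (w : TimeSet T → TimeSet T → ℝ≥0∞) : Prop extends IsControl w where
  right_lim : ∀ s t, s < t → Tendsto (fun u => w u t) (𝓝[>] s) (𝓝 (w s t))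
  left_lim : ∀ s t, s < t → Tendsto (fun u => w s u) (𝓝[<] t) (𝓝 (w s t))
  small : ∀ s, Tendsto (fun t => w s t) (𝓝[>] s) (𝓝 0)

/-- `π 0 < π 1 < ⋯ < π n` is a partition of `[s,t]`. -/
def IsPartition (s t : TimeSet T) (n : ℕ) (π : ℕ → TimeSet T) : Prop :=
  π 0 = s ∧ π n = t ∧ ∀ i < n, π i < π (i + 1)

/-- The `p`-variation over `[s,t]` of a two-parameter function `F` with values in `[0,∞]`. -/
def pVar (p : ℝ) (F : TimeSet T → TimeSet T → ℝ≥0∞) (s t : TimeSet T) : ℝ≥0∞ :=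
  (⨆ (n : ℕ) (π : ℕ → TimeSet T) (_ : IsPartition s t n π),
    ∑ i ∈ Finset.range n, F (π i) (π (i + 1)) ^ p) ^ (1 / p)

/-- The `p`-variation over `[s,t)`, the (increasing) limit of those over `[s,v]` as `v ↑ t`;
it is `0` if `s = t`. -/
def pVarIco (p : ℝ) (F : TimeSet T → TimeSet T → ℝ≥0∞) (s t : TimeSet T) : ℝ≥0∞ :=
  ⨆ v ∈ Set.Ico s t, pVar p F s v

/-- The `p`-variation over `(s,t)`, the (increasing) limit of those over `[u,v]` as `u ↓ s` and
`v ↑ t`; it is `0` if `s = t`. -/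
def pVarIoo (p : ℝ) (F : TimeSet T → TimeSet T → ℝ≥0∞) (s t : TimeSet T) : ℝ≥0∞ :=
  ⨆ u ∈ Set.Ioo s t, ⨆ v ∈ Set.Ico u t, pVar p F u v

/-- `inf {u > a | w(a,u) ≥ α} ∧ t`, with `inf ∅ = ∞`. -/
def nextTime (w : TimeSet T → TimeSet T → ℝ≥0∞) (α : ℝ≥0∞) (t a : TimeSet T) : TimeSet T :=
  ⟨sInf (insert (t : ℝ) ((fun u : TimeSet T => (u : ℝ)) '' {u | a < u ∧ α ≤ w a u})), by
    have hlb : ∀ x ∈ insert (t : ℝ) ((fun u : TimeSet T => (u : ℝ)) '' {u | a < u ∧ α ≤ w a u}),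
        (0 : ℝ) ≤ x := by
      rintro x (rfl | ⟨u, -, rfl⟩)
      · exact t.2.1
      · exact u.2.1
    exact ⟨le_csInf ⟨_, Set.mem_insert _ _⟩ hlb,
      (csInf_le ⟨0, hlb⟩ (Set.mem_insert _ _)).trans t.2.2⟩⟩

/-- The greedy times `t_i(α)` of `w` on `[s,t]`. -/
def greedyTime (w : TimeSet T → TimeSet T → ℝ≥0∞) (α : ℝ≥0∞) (s t : TimeSet T) : ℕ → TimeSet T
  | 0 => s
  | i + 1 => nextTime w α t (greedyTime w α s t i)

/-- `N_{α,[s,t]}(w) = sup {n | t_n(α) < t}` (with value `0` if `s = t`). -/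
def countN (w : TimeSet T → TimeSet T → ℝ≥0∞) (α : ℝ≥0∞) (s t : TimeSet T) : ℕ∞ :=
  ⨆ (n : ℕ) (_ : greedyTime w α s t n < t), (n : ℕ∞)

end Deterministic

/-! ### Stochastic notions -/

section Stochastic

variable {T : ℝ} {Ω : Type u} {mΩ : MeasurableSpace Ω} {E : Type v} [NormedAddCommGroup E]

/-- The usual conditions: right-continuity, and every `P`-null set belongs to every `𝓕 t`. -/
structure UsualConditions (P : Measure Ω) (𝓕 : Filtration (TimeSet T) mΩ) : Prop where
  rightContinuous : 𝓕.IsRightContinuous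
  complete : ∀ A : Set Ω, P A = 0 → ∀ t, MeasurableSet[𝓕 t] A

/-- Right-continuous with left limits (in `E`). -/
def IsCadlagPath (f : TimeSet T → E) : Prop :=
  ∀ t, ContinuousWithinAt f (Set.Ioi t) t ∧ ∃ l, Tendsto f (𝓝[<] t) (𝓝 l)

/-- Almost all paths are càdlàg. -/
def IsCadlag (P : Measure Ω) (V : TimeSet T → Ω → E) : Prop :=
  ∀ᵐ ω ∂P, IsCadlagPath fun t => V t ω

/-- `V_{t-}`, with the convention `V_{0-} = V_0`. -/
def leftLimit (V : TimeSet T → Ω → E) (t : TimeSet T) (ω : Ω) : E :=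
  Function.leftLim (fun s => V s ω) t

/-- The jump `ΔV_t = V_t - V_{t-}`, with `ΔV_0 = 0`. -/
def jump (V : TimeSet T → Ω → E) (t : TimeSet T) (ω : Ω) : E :=
  V t ω - leftLimit V t ω

/-- The modulus of mean variation `ρ_{s,t}(V) = sup ‖𝔼_σ |V_τ - V_{σ-}|‖_∞`, the supremum being over
all stopping times `s ≤ σ ≤ τ ≤ t`. -/
def rho (P : Measure Ω) (𝓕 : Filtration (TimeSet T) mΩ) (V : TimeSet T → Ω → E)
    (s t : TimeSet T) : ℝ≥0∞ :=
  ⨆ (σ : Ω → TimeSet T) (τ : Ω → TimeSet T)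
    (hσ : IsStoppingTime 𝓕 fun ω => (σ ω : WithTop (TimeSet T)))
    (_ : IsStoppingTime 𝓕 fun ω => (τ ω : WithTop (TimeSet T)))
    (_ : ∀ ω, s ≤ σ ω ∧ σ ω ≤ τ ω ∧ τ ω ≤ t),
    essSup (condLExp hσ.measurableSpace P fun ω => ‖V (τ ω) ω - leftLimit V (σ ω) ω‖ₑ) P

/-- `V` belongs to `BMO^{p-var}`. -/
structure IsBMOpVar (hT : 0 < T) (p : ℝ) (P : Measure Ω) (𝓕 : Filtration (TimeSet T) mΩ)
    (V : TimeSet T → Ω → E) : Prop where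
  adapted : StronglyAdapted 𝓕 V
  cadlag : IsCadlag P V
  finite : pVar p (rho P 𝓕 V) (start hT) (finish hT) < ∞

/-- The two-parameter function `‖δV_{s,t}‖_{q,∞,s} = ‖𝔼_s |V_t - V_s|^q‖_∞^{1/q}`. -/
def condNorm (q : ℝ) (P : Measure Ω) (𝓕 : Filtration (TimeSet T) mΩ) (V : TimeSet T → Ω → E)
    (s t : TimeSet T) : ℝ≥0∞ :=
  essSup (condLExp (𝓕 s) P fun ω => ‖V t ω - V s ω‖ₑ ^ q) P ^ (1 / q)

/-- `V` belongs to `V^p L^{q,∞}`. -/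
structure MemVpLqInfty (hT : 0 < T) (p q : ℝ) (P : Measure Ω) (𝓕 : Filtration (TimeSet T) mΩ)
    (V : TimeSet T → Ω → E) : Prop where
  cadlag : IsCadlag P V
  initial : MemLp (V (start hT)) (ENNReal.ofReal q) P
  finite : pVar p (condNorm q P 𝓕 V) (start hT) (finish hT) < ∞

/-- The jump process `Γ_{s,t} = sup_{u ∈ [s,t]} |ΔV_u|`. -/
def Gam (V : TimeSet T → Ω → E) (s t : TimeSet T) (ω : Ω) : ℝ≥0∞ :=
  ⨆ u ∈ Set.Icc s t, ‖jump V u ω‖ₑ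

/-- The two-parameter function `‖Γ_{s,t}‖_∞`. -/
def GamNorm (P : Measure Ω) (V : TimeSet T → Ω → E) (s t : TimeSet T) : ℝ≥0∞ :=
  essSup (Gam V s t) P

/-- The control `(s,t) ↦ ‖V‖_{BMO^{p-var},(s,t)}^p`. -/
def bmoControl (p : ℝ) (P : Measure Ω) (𝓕 : Filtration (TimeSet T) mΩ) (V : TimeSet T → Ω → E)
    (s t : TimeSet T) : ℝ≥0∞ :=
  pVarIoo p (rho P 𝓕 V) s t ^ p

/-- The control `(s,t) ↦ ‖V‖_{p,1,∞,[s,t)}^p + ‖Γ‖_{p,∞,(s,t)}^p`. -/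
def jumpControl (p : ℝ) (P : Measure Ω) (𝓕 : Filtration (TimeSet T) mΩ) (V : TimeSet T → Ω → E)
    (s t : TimeSet T) : ℝ≥0∞ :=
  pVarIco p (condNorm 1 P 𝓕 V) s t ^ p + pVarIoo p (GamNorm P V) s t ^ p

/-- `sup_{t ∈ (r,T]} ‖ΔV_t‖_∞`. -/
def supJump (P : Measure Ω) (V : TimeSet T → Ω → E) (r : TimeSet T) : ℝ≥0∞ :=
  ⨆ t ∈ Set.Ioi r, eLpNorm (jump V t) ∞ P

/-- `‖𝔼_r [exp (lam * sup_{t ∈ [r,T]} |V_t - V_r|)]‖_∞`. -/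
def expMoment (lam : ℝ) (P : Measure Ω) (𝓕 : Filtration (TimeSet T) mΩ) (V : TimeSet T → Ω → E)
    (r : TimeSet T) : ℝ≥0∞ :=
  essSup (condLExp (𝓕 r) P fun ω =>
    EReal.exp ((ENNReal.ofReal lam * ⨆ t ∈ Set.Ici r, ‖V t ω - V r ω‖ₑ : ℝ≥0∞) : EReal)) P

/-- The inequality
`‖𝔼_r [exp (lam * sup_{t ∈ [r,T]} |V_t - V_r|)]‖_∞ ≤ exp (C (N + 1) (1 + sup_{t ∈ (r,T]} ‖ΔV_t‖_∞))`
with `N = N_{α,[r,T]}(w)`, including the finiteness of its right-hand side. -/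
def ExpBound (hT : 0 < T) (C α lam : ℝ) (w : TimeSet T → TimeSet T → ℝ≥0∞) (P : Measure Ω)
    (𝓕 : Filtration (TimeSet T) mΩ) (V : TimeSet T → Ω → E) (r : TimeSet T) : Prop :=
  countN w (ENNReal.ofReal α) r (finish hT) ≠ ⊤ ∧ supJump P V r ≠ ∞ ∧
    expMoment lam P 𝓕 V r ≤
      EReal.exp ((ENNReal.ofReal C * ((countN w (ENNReal.ofReal α) r (finish hT) : ℝ≥0∞) + 1) *
        (1 + supJump P V r) : ℝ≥0∞) : EReal)

end Stochastic

end JohnNirenberg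

end

open MeasureTheory Filter Topology Set
open scoped ENNReal

noncomputable section

namespace JohnNirenberg

universe u v

/-! ### Variation sums as superadditive functions. -/

section Deterministic

variable {T : ℝ} {p : ℝ} {F W : TimeSet T → TimeSet T → ℝ≥0∞}

/-! The engine is the John–Nirenberg inequality on one interval [u,v] (`johnNirenberg`). Let σ and τ
be the first times at which |V - V_u| exceeds c and c + a. Then |V_{σ-} - V_u| ≤ c and |V_τ - V_u| ≥
c + a, so |V_τ - V_{σ-}| ≥ a, while ρ bounds its conditional mean at σ. Raising the level by a
therefore multiplies the probability by at most ρ/a, even conditionally on time u. The tails of the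
maximal increment decay geometrically, and they beat exp(λx) once ρ ≤ exp(-λ)/2.

To globalize, both controls are inner regularizations of superadditive functions. If w(s,t) is
small, then ρ is small on every [u,v] strictly inside (s,t). Fatou's lemma extends the exponential
bound to [s,t], where right-continuity handles s and only the jump at t is lost (`expLe_interval`).
Such bounds multiply over adjacent intervals by the tower property (`ExpLe.trans`). Each greedy
interval has w ≤ α and is cut into a number of small pieces depending only on p, α, λ; there are N +
1 greedy intervals, which gives the stated exponent.

The classes are compared through ρ ≤ 2c + ‖Γ‖, where c bounds the conditional means of |V_v - V_x|
(`rho_le_of_condNorm`). Conversely, ‖Γ‖ ≤ ρ because countably many stopping times exhaust the jumps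
(`GamNorm_le_rho`), and conditional q-th moments are bounded by ρ through the same tail estimate
(`condNorm_le_rho`). The exponent q enters only through finiteness, so it does not affect C.

Throughout, an L^∞ bound on a conditional expectation is read as an inequality of integrals over all
events of the σ-algebra (`essSup_condLExp_le_iff`). -/

/-- Superadditivity of a function of the pairs `s ≤ t`. -/
def Superadd (W : TimeSet T → TimeSet T → ℝ≥0∞) : Prop :=
  ∀ s u t, s ≤ u → u ≤ t → W s u + W u t ≤ W s t

/-- The supremum of the `p`-variation sums, i.e. the `p`-th power of the `p`-variation. -/
def pSum (p : ℝ) (F : TimeSet T → TimeSet T → ℝ≥0∞) (s t : TimeSet T) : ℝ≥0∞ :=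
  ⨆ (x : ℕ × (ℕ → TimeSet T)) (_ : IsPartition s t x.1 x.2),
    ∑ i ∈ Finset.range x.1, F (x.2 i) (x.2 (i + 1)) ^ p

lemma pVar_eq (p : ℝ) (F : TimeSet T → TimeSet T → ℝ≥0∞) (s t : TimeSet T) :
    pVar p F s t = pSum p F s t ^ (1 / p) := by
  rw [pVar, pSum, iSup_prod]

lemma pVar_rpow (hp : 1 ≤ p) (F : TimeSet T → TimeSet T → ℝ≥0∞) (s t : TimeSet T) :
    pVar p F s t ^ p = pSum p F s t := by
  rw [pVar_eq, ← ENNReal.rpow_mul, one_div, inv_mul_cancel₀ (by linarith), ENNReal.rpow_one]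

lemma pVar_lt_top_iff (hp : 1 ≤ p) (s t : TimeSet T) :
    pVar p F s t < ∞ ↔ pSum p F s t < ∞ := by
  rw [pVar_eq, ENNReal.rpow_lt_top_iff_of_pos (by positivity)]

lemma exists_isPartition {s t : TimeSet T} (h : s ≤ t) :
    ∃ x : ℕ × (ℕ → TimeSet T), IsPartition s t x.1 x.2 := by
  rcases h.eq_or_lt with rfl | h
  · exact ⟨(0, fun _ => s), rfl, rfl, fun i hi => absurd hi (Nat.not_lt_zero _)⟩
  · refine ⟨(1, fun i => if i = 0 then s else t), by simp, by simp, fun i hi => ?_⟩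
    obtain rfl : i = 0 := by simpa using hi
    simpa using h

lemma IsPartition.append {s u t : TimeSet T} {n m : ℕ} {π π' : ℕ → TimeSet T}
    (h : IsPartition s u n π) (h' : IsPartition u t m π') :
    IsPartition s t (n + m) fun i => if i < n then π i else π' (i - n) := by
  refine ⟨?_, by simpa using h'.2.1, fun i hi => ?_⟩
  · by_cases hn : 0 < n
    · simpa [hn] using h.1
    · obtain rfl : n = 0 := by omega
      simp only [lt_self_iff_false, if_false, Nat.sub_zero]
      rw [h'.1, ← h.2.1, h.1]
  · by_cases h1 : i + 1 < n
    · have : i < n := by omega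
      simpa [h1, this] using h.2.2 i this
    · by_cases h2 : i < n
      · obtain rfl : n = i + 1 := by omega
        simpa [h'.1, ← h.2.1] using h.2.2 i h2
      · have := h'.2.2 (i - n) (by omega)
        simpa [h1, h2, show i + 1 - n = i - n + 1 by omega] using this

lemma IsPartition.sum_le_pSum (p : ℝ) (F : TimeSet T → TimeSet T → ℝ≥0∞) {s t : TimeSet T} {n : ℕ}
    {π : ℕ → TimeSet T} (h : IsPartition s t n π) :
    ∑ i ∈ Finset.range n, F (π i) (π (i + 1)) ^ p ≤ pSum p F s t :=
  le_iSup₂ (α := ℝ≥0∞)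
    (f := fun (x : ℕ × (ℕ → TimeSet T)) (_ : IsPartition s t x.1 x.2) =>
      ∑ i ∈ Finset.range x.1, F (x.2 i) (x.2 (i + 1)) ^ p) (n, π) h

lemma superadd_pSum (p : ℝ) (F : TimeSet T → TimeSet T → ℝ≥0∞) : Superadd (pSum p F) := by
  intro s u t hsu hut
  refine ENNReal.biSup_add_biSup_le' (exists_isPartition hsu) (exists_isPartition hut) ?_
  rintro ⟨n, π⟩ h ⟨m, π'⟩ h'
  simp only at h h'
  refine le_trans (le_of_eq ?_) ((h.append h').sum_le_pSum p F)
  simp only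
  rw [Finset.sum_range_add]
  refine congr_arg₂ _ (Finset.sum_congr rfl fun i hi => ?_) (Finset.sum_congr rfl fun i hi => ?_)
  · have hi : i < n := by simpa using hi
    by_cases h1 : i + 1 < n
    · simp [hi, h1]
    · obtain rfl : n = i + 1 := by omega
      simp [h.2.1, h'.1]
  · simp [show n + i + 1 - n = i + 1 by omega, show ¬ n + i + 1 < n by omega]

lemma Superadd.mono (h : Superadd W) {s s' t t' : TimeSet T} (h1 : s' ≤ s) (h2 : s ≤ t)
    (h3 : t ≤ t') : W s t ≤ W s' t' :=
  calc W s t ≤ W s' s + W s t := le_add_self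
    _ ≤ W s' t := h _ _ _ h1 h2
    _ ≤ W s' t + W t t' := le_self_add
    _ ≤ W s' t' := h _ _ _ (h1.trans h2) h3

lemma rpow_le_pSum (p : ℝ) (F : TimeSet T → TimeSet T → ℝ≥0∞) {s t : TimeSet T} (h : s < t) :
    F s t ^ p ≤ pSum p F s t := by
  have hpart : IsPartition s t 1 fun i => if i = 0 then s else t := by
    refine ⟨by simp, by simp, fun i hi => ?_⟩
    obtain rfl : i = 0 := by simpa using hi
    simpa using h
  exact le_trans (by simp) (hpart.sum_le_pSum p F)

lemma IsPartition.le {s t : TimeSet T} {n : ℕ} {π : ℕ → TimeSet T} (h : IsPartition s t n π) :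
    ∀ i ≤ n, s ≤ π i := by
  intro i
  induction i with
  | zero => intro _; exact h.1.ge
  | succ i ih => intro hi; exact (ih (by omega)).trans (h.2.2 i (by omega)).le

lemma IsPartition.tail {s t : TimeSet T} {n : ℕ} {π : ℕ → TimeSet T}
    (h : IsPartition s t (n + 1) π) : IsPartition (π 1) t n fun i => π (i + 1) :=
  ⟨rfl, h.2.1, fun i hi => h.2.2 (i + 1) (by omega)⟩

lemma sum_le_of_superadd (h : Superadd W) {n : ℕ} :
    ∀ {s t : TimeSet T} {π : ℕ → TimeSet T}, IsPartition s t n π →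
      ∑ i ∈ Finset.range n, W (π i) (π (i + 1)) ≤ W s t := by
  induction n with
  | zero => intros; simp
  | succ n ih =>
    intro s t π hπ
    rw [Finset.sum_range_succ']
    have h1 := hπ.le 1 (by omega)
    have h2 : π 1 ≤ t := by
      have := hπ.tail.le n le_rfl
      rwa [hπ.2.1] at this
    calc _ ≤ W (π 1) t + W s (π 1) := by
          gcongr
          · exact ih hπ.tail
          · simp [hπ.1]
      _ ≤ W s t := by rw [add_comm]; exact h _ _ _ h1 h2

/-- A superadditive majorant absorbs every partition sum. This is how finiteness of one variation is
deduced from that of another. -/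
lemma pSum_le_of_superadd (h : Superadd W) (hF : ∀ s t, s < t → F s t ^ p ≤ W s t)
    (s t : TimeSet T) : pSum p F s t ≤ W s t := by
  refine iSup₂_le fun x hx => le_trans ?_ (sum_le_of_superadd h hx)
  exact Finset.sum_le_sum fun i hi => hF _ _ (hx.2.2 i (by simpa using hi))

lemma Superadd.const_mul (h : Superadd W) (c : ℝ≥0∞) : Superadd fun s t => c * W s t := by
  intro s u t h1 h2
  simp only [← mul_add]
  exact mul_le_mul_right (h s u t h1 h2) c

lemma Superadd.add {W' : TimeSet T → TimeSet T → ℝ≥0∞} (h : Superadd W) (h' : Superadd W') :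
    Superadd fun s t => W s t + W' s t := by
  intro s u t h1 h2
  calc _ = (W s u + W u t) + (W' s u + W' u t) := by ring
    _ ≤ _ := add_le_add (h s u t h1 h2) (h' s u t h1 h2)

lemma le_pVar (hp : 1 ≤ p) {s t : TimeSet T} (h : s < t) : F s t ≤ pVar p F s t := by
  have := rpow_le_pSum p F h
  rwa [← pVar_rpow hp, ENNReal.rpow_le_rpow_iff (by linarith)] at this

lemma pVar_mono (hp : 1 ≤ p) {s s' t t' : TimeSet T} (h1 : s' ≤ s) (h2 : s ≤ t)
    (h3 : t ≤ t') : pVar p F s t ≤ pVar p F s' t' := by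
  rw [pVar_eq, pVar_eq]
  exact ENNReal.rpow_le_rpow ((superadd_pSum p F).mono h1 h2 h3) (by positivity)

/-! ### Inner regularization and regular controls. -/

/-- The inner regularization `W(s+,t-)` of a superadditive function. -/
def inner (W : TimeSet T → TimeSet T → ℝ≥0∞) (s t : TimeSet T) : ℝ≥0∞ :=
  ⨆ u ∈ Set.Ioo s t, ⨆ v ∈ Set.Ico u t, W u v

lemma lt_inner_iff {c : ℝ≥0∞} {s t : TimeSet T} :
    c < inner W s t ↔ ∃ u v, s < u ∧ u ≤ v ∧ v < t ∧ c < W u v := by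
  simp only [inner, lt_iSup_iff, mem_Ioo, mem_Ico]
  constructor
  · rintro ⟨u, ⟨h1, -⟩, v, ⟨h2, h3⟩, h4⟩
    exact ⟨u, v, h1, h2, h3, h4⟩
  · rintro ⟨u, v, h1, h2, h3, h4⟩
    exact ⟨u, ⟨h1, h2.trans_lt h3⟩, v, ⟨h2, h3⟩, h4⟩

lemma le_inner {s u v t : TimeSet T} (h1 : s < u) (h2 : u ≤ v) (h3 : v < t) :
    W u v ≤ inner W s t :=
  le_of_forall_lt fun _ hc => lt_inner_iff.2 ⟨u, v, h1, h2, h3, hc⟩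

lemma inner_le_iff {c : ℝ≥0∞} {s t : TimeSet T} :
    inner W s t ≤ c ↔ ∀ u v, s < u → u ≤ v → v < t → W u v ≤ c := by
  refine ⟨fun h u v h1 h2 h3 => (le_inner h1 h2 h3).trans h, fun h => ?_⟩
  refine le_of_not_gt fun hc => ?_
  obtain ⟨u, v, h1, h2, h3, h4⟩ := lt_inner_iff.1 hc
  exact absurd (h u v h1 h2 h3) h4.not_ge

lemma inner_mono {s s' t t' : TimeSet T} (h1 : s' ≤ s) (h3 : t ≤ t') :
    inner W s t ≤ inner W s' t' :=
  inner_le_iff.2 fun _ _ a b c => le_inner (h1.trans_lt a) b (c.trans_le h3)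

lemma inner_le (h : Superadd W) {s t : TimeSet T} : inner W s t ≤ W s t :=
  inner_le_iff.2 fun _ _ a b c => h.mono a.le b c.le

/-- Near-optimal intervals inside (s,u) and (u,t) are joined across the gap at u by stretching the
second one to the left. -/
lemma superadd_inner (h : Superadd W) : Superadd (inner W) := by
  intro s u t hsu hut
  refine ENNReal.le_of_forall_pos_le_add fun ε hε _ => ?_
  by_contra hcon
  rw [not_le] at hcon
  have hpos : (ε : ℝ≥0∞) ≠ 0 := by simpa using hε.ne'
  have hlt : inner W s t < inner W s u + inner W u t := lt_of_le_of_lt le_self_add hcon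
  -- Nothing lies strictly below a summand equal to zero, so such a summand is kept as it is and
  -- only positive ones are approximated from below.
  obtain ⟨a, ha, b, hb, hab⟩ : ∃ a, a ≤ inner W s u ∧ ∃ b, b ≤ inner W u t ∧
      inner W s t < a + b ∧ (a = 0 ∨ a < inner W s u) ∧ (b = 0 ∨ b < inner W u t) := by
    by_cases h0 : inner W s u = 0
    · by_cases h1 : inner W u t = 0
      · simp [h0, h1] at hlt
      · rw [h0, zero_add] at hlt
        obtain ⟨b, hb1, hb2⟩ := exists_between hlt
        exact ⟨0, by simp, b, hb2.le, by simpa using hb1, Or.inl rfl, Or.inr hb2⟩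
    · by_cases h1 : inner W u t = 0
      · rw [h1, add_zero] at hlt
        obtain ⟨b, hb1, hb2⟩ := exists_between hlt
        exact ⟨b, hb2.le, 0, by simp, by simpa using hb1, Or.inr hb2, Or.inl rfl⟩
      · obtain ⟨a, ha, b, hb, hab⟩ := ENNReal.exists_lt_add_of_lt_add hlt h0 h1
        exact ⟨a, ha.le, b, hb.le, hab, Or.inr ha, Or.inr hb⟩
  obtain ⟨hlt', ha', hb'⟩ := hab
  refine absurd hlt' (not_lt.2 ?_)
  rcases ha' with rfl | ha'
  · rw [zero_add]
    exact hb.trans (inner_mono hsu le_rfl)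
  rcases hb' with rfl | hb'
  · rw [add_zero]
    exact ha.trans (inner_mono le_rfl hut)
  obtain ⟨u1, v1, h1, h2, h3, h4⟩ := lt_inner_iff.1 ha'
  obtain ⟨u2, v2, k1, k2, k3, k4⟩ := lt_inner_iff.1 hb'
  have hvu : v1 ≤ u2 := (h3.trans k1).le
  calc a + b ≤ W u1 v1 + W v1 v2 := add_le_add h4.le (k4.le.trans (h.mono hvu k2 le_rfl))
    _ ≤ W u1 v2 := h _ _ _ h2 (hvu.trans k2)
    _ ≤ inner W s t := le_inner h1 (h2.trans (hvu.trans k2)) k3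

/-- Smallness on short intervals is automatic: w(s,u) ≤ w(s,t) - w(u,t), and the right side tends to
0 as u ↓ s because w(s,t) is finite. -/
lemma isRegularControl_of_lim {w : TimeSet T → TimeSet T → ℝ≥0∞} (hw : IsControl w)
    (hr : ∀ s t, s < t → Tendsto (fun u => w u t) (𝓝[>] s) (𝓝 (w s t)))
    (hl : ∀ s t, s < t → Tendsto (fun u => w s u) (𝓝[<] t) (𝓝 (w s t))) :
    IsRegularControl w := by
  refine ⟨hw, hr, hl, fun s => ?_⟩
  by_cases hs : ∃ t, s < t
  swap
  · have : Set.Ioi s = ∅ := by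
      ext t
      simpa using fun h => hs ⟨t, h⟩
    simp [this]
  obtain ⟨t, hst⟩ := hs
  have hlim : Tendsto (fun u => w s t - w u t) (𝓝[>] s) (𝓝 (w s t - w s t)) :=
    ENNReal.Tendsto.sub tendsto_const_nhds (hr s t hst) (Or.inl (hw.finite s t hst.le))
  rw [tsub_self] at hlim
  refine tendsto_of_tendsto_of_tendsto_of_le_of_le' tendsto_const_nhds hlim
    (Eventually.of_forall fun _ => zero_le) ?_
  filter_upwards [Ioo_mem_nhdsGT hst] with u hu
  exact ENNReal.le_sub_of_add_le_right (hw.finite u t hu.2.le)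
    (hw.superadditive s u t hu.1.le hu.2.le)

/-- An interval [u,v] witnessing a lower bound lies strictly inside (s,t), so it stays admissible
when the endpoints move in slightly; the upper bounds are monotonicity. -/
lemma isRegularControl_inner (h : Superadd W) (hfin : ∀ s t, s ≤ t → W s t ≠ ∞) :
    IsRegularControl (inner W) := by
  refine isRegularControl_of_lim ⟨fun s t hst => ((inner_le h).trans_lt
    (lt_top_iff_ne_top.2 (hfin s t hst))).ne, superadd_inner h⟩ ?_ ?_
  · intro s t _
    refine tendsto_order.2 ⟨fun c hc => ?_, fun c hc => ?_⟩
    · obtain ⟨u, v, h1, h2, h3, h4⟩ := lt_inner_iff.1 hc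
      filter_upwards [Ioo_mem_nhdsGT h1] with x hx
      exact lt_inner_iff.2 ⟨u, v, hx.2, h2, h3, h4⟩
    · filter_upwards [self_mem_nhdsWithin] with x hx
      exact lt_of_le_of_lt (inner_mono (le_of_lt hx) le_rfl) hc
  · intro s t _
    refine tendsto_order.2 ⟨fun c hc => ?_, fun c hc => ?_⟩
    · obtain ⟨u, v, h1, h2, h3, h4⟩ := lt_inner_iff.1 hc
      filter_upwards [Ioo_mem_nhdsLT h3] with x hx
      exact lt_inner_iff.2 ⟨u, v, h1, h2, hx.1, h4⟩
    · filter_upwards [self_mem_nhdsWithin] with x hx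
      exact lt_of_le_of_lt (inner_mono le_rfl (le_of_lt hx)) hc

lemma iSup_rpow {ι : Sort*} (hp : 1 ≤ p) (f : ι → ℝ≥0∞) : (⨆ i, f i) ^ p = ⨆ i, f i ^ p :=
  (ENNReal.orderIsoRpow p (by linarith)).map_iSup f

lemma pVarIoo_rpow (hp : 1 ≤ p) (F : TimeSet T → TimeSet T → ℝ≥0∞) (s t : TimeSet T) :
    pVarIoo p F s t ^ p = inner (pSum p F) s t := by
  simp only [pVarIoo, inner, iSup_rpow hp, pVar_rpow hp]

/-- If `F` is lower semicontinuous from the right in its first argument, then the `p`-variations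
over `[s,t)` and over `(s,t)` agree. -/
lemma pVarIco_rpow (hp : 1 ≤ p) (hF : ∀ s t, s < t → F s t ≤ ⨆ u ∈ Set.Ioo s t, F u t)
    (s t : TimeSet T) : pVarIco p F s t ^ p = inner (pSum p F) s t := by
  simp only [pVarIco, iSup_rpow hp, pVar_rpow hp]
  apply le_antisymm
  · refine iSup₂_le fun v hv => iSup₂_le ?_
    rintro ⟨n, π⟩ hπ
    cases n with
    | zero => simp
    | succ n =>
      simp only
      rw [Finset.sum_range_succ', add_comm]
      have h01 : s < π 1 := by
        have := hπ.2.2 0 (by omega)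
        rwa [hπ.1] at this
      simp only [zero_add]
      rw [show π 0 = s from hπ.1]
      have h2 : π 1 ≤ v := by
        have := hπ.tail.le n le_rfl
        rwa [hπ.2.1] at this
      -- Only the first increment of the partition touches the excluded endpoint s; it is
      -- approximated by increments starting at u > s.
      have key : F s (π 1) ^ p ≤ ⨆ u ∈ Set.Ioo s (π 1), F u (π 1) ^ p := by
        simp only [← iSup_rpow hp]
        exact ENNReal.rpow_le_rpow (hF _ _ h01) (by linarith)
      obtain ⟨x0, hx0⟩ := exists_between h01
      refine (add_le_add_left key _).trans ?_
      rw [ENNReal.biSup_add' ⟨x0, hx0⟩]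
      refine iSup₂_le fun u hu => ?_
      refine le_trans ?_ (le_inner hu.1 (hu.2.le.trans h2) hv.2)
      refine le_trans ?_ (superadd_pSum p F u (π 1) v hu.2.le h2)
      refine add_le_add (rpow_le_pSum p F hu.2) ?_
      exact hπ.tail.sum_le_pSum p F
  · refine inner_le_iff.2 fun u v h1 h2 h3 => ?_
    exact ((superadd_pSum p F).mono h1.le h2 le_rfl).trans
      (le_iSup₂ (f := fun v (_ : v ∈ Set.Ico s t) => pSum p F s v) v ⟨h1.le.trans h2, h3⟩)

lemma inner_add {W' : TimeSet T → TimeSet T → ℝ≥0∞} (h : Superadd W) (h' : Superadd W')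
    (s t : TimeSet T) : inner W s t + inner W' s t = inner (fun s t => W s t + W' s t) s t := by
  by_cases hst : s < t
  swap
  · have (W : TimeSet T → TimeSet T → ℝ≥0∞) : inner W s t = 0 :=
      nonpos_iff_eq_zero.1 (inner_le_iff.2 fun u v h1 h2 h3 => absurd (h1.trans_le h2 |>.trans h3) hst)
    simp [this]
  apply le_antisymm
  · obtain ⟨x0, hx0⟩ := exists_between hst
    have conv (W : TimeSet T → TimeSet T → ℝ≥0∞) : inner W s t =
        ⨆ (x : TimeSet T × TimeSet T) (_ : s < x.1 ∧ x.1 ≤ x.2 ∧ x.2 < t), W x.1 x.2 := by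
      apply le_antisymm
      · exact inner_le_iff.2 fun u v h1 h2 h3 => le_iSup₂ (α := ℝ≥0∞)
          (f := fun (x : TimeSet T × TimeSet T) (_ : s < x.1 ∧ x.1 ≤ x.2 ∧ x.2 < t) => W x.1 x.2)
          (u, v) ⟨h1, h2, h3⟩
      · exact iSup₂_le fun x hx => le_inner hx.1 hx.2.1 hx.2.2
    rw [conv W, conv W']
    refine ENNReal.biSup_add_biSup_le' ⟨(x0, x0), hx0.1, le_rfl, hx0.2⟩
      ⟨(x0, x0), hx0.1, le_rfl, hx0.2⟩ ?_
    -- The family of inner intervals is directed: two of them lie in a common one, on which both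
    -- functions are at least as large.
    rintro ⟨u, v⟩ ⟨h1, h2, h3⟩ ⟨u', v'⟩ ⟨k1, k2, k3⟩
    refine le_trans ?_ (le_inner (W := fun s t => W s t + W' s t) (u := min u u') (v := max v v')
      (lt_min h1 k1) ((min_le_left _ _).trans (h2.trans (le_max_left _ _))) (max_lt h3 k3))
    exact add_le_add (h.mono (min_le_left _ _) h2 (le_max_left _ _))
      (h'.mono (min_le_right _ _) k2 (le_max_right _ _))
  · exact inner_le_iff.2 fun u v h1 h2 h3 => add_le_add (le_inner h1 h2 h3) (le_inner h1 h2 h3)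

/-! ### Capped infima and greedy times. -/

/-- The infimum of `S ∪ {v}`. -/
def infTime (v : TimeSet T) (S : Set (TimeSet T)) : TimeSet T :=
  ⟨sInf (insert (v : ℝ) ((fun u : TimeSet T => (u : ℝ)) '' S)), by
    have hlb : ∀ x ∈ insert (v : ℝ) ((fun u : TimeSet T => (u : ℝ)) '' S), (0 : ℝ) ≤ x := by
      rintro x (rfl | ⟨u, -, rfl⟩)
      · exact v.2.1
      · exact u.2.1
    exact ⟨le_csInf ⟨_, Set.mem_insert _ _⟩ hlb,
      (csInf_le ⟨0, hlb⟩ (Set.mem_insert _ _)).trans v.2.2⟩⟩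

lemma infTime_lt_iff {v x : TimeSet T} {S : Set (TimeSet T)} :
    infTime v S < x ↔ v < x ∨ ∃ y ∈ S, y < x := by
  have hb : BddBelow (insert (v : ℝ) ((fun u : TimeSet T => (u : ℝ)) '' S)) := by
    refine ⟨0, ?_⟩
    rintro x (rfl | ⟨u, -, rfl⟩)
    · exact v.2.1
    · exact u.2.1
  rw [← Subtype.coe_lt_coe, infTime, csInf_lt_iff hb ⟨_, Set.mem_insert _ _⟩]
  constructor
  · rintro ⟨y, rfl | ⟨u, hu, rfl⟩, hy⟩
    · exact Or.inl hy
    · exact Or.inr ⟨u, hu, hy⟩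
  · rintro (h | ⟨u, hu, hy⟩)
    · exact ⟨v, Set.mem_insert _ _, h⟩
    · exact ⟨u, Set.mem_insert_of_mem _ ⟨u, hu, rfl⟩, hy⟩

lemma le_infTime_iff {v x : TimeSet T} {S : Set (TimeSet T)} :
    x ≤ infTime v S ↔ x ≤ v ∧ ∀ y ∈ S, x ≤ y := by
  rw [← not_lt, infTime_lt_iff]
  push Not
  rfl

lemma infTime_le (v : TimeSet T) (S : Set (TimeSet T)) : infTime v S ≤ v :=
  (le_infTime_iff.1 le_rfl).1

lemma infTime_le_of_mem {v y : TimeSet T} {S : Set (TimeSet T)} (h : y ∈ S) : infTime v S ≤ y :=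
  (le_infTime_iff.1 le_rfl).2 y h

variable {w : TimeSet T → TimeSet T → ℝ≥0∞} {α : ℝ≥0∞} {a t : TimeSet T}

lemma nextTime_le : nextTime w α t a ≤ t := infTime_le _ _

lemma le_nextTime (h : a ≤ t) : a ≤ nextTime w α t a :=
  le_infTime_iff.2 ⟨h, fun _ hy => hy.1.le⟩

/-- Before the greedy time the control is below α; left-continuity carries this to the greedy time
itself. -/
lemma IsRegularControl.nextTime_le_threshold (hw : IsRegularControl w)
    (h : a < nextTime w α t a) : w a (nextTime w α t a) ≤ α := by
  have : (𝓝[<] nextTime w α t a).NeBot := nhdsLT_neBot_of_exists_lt ⟨a, h⟩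
  refine le_of_tendsto (hw.left_lim _ _ h) ?_
  filter_upwards [Ioo_mem_nhdsLT h] with u hu
  by_contra hcon
  have : nextTime w α t a ≤ u := infTime_le_of_mem ⟨hu.1, (not_le.1 hcon).le⟩
  exact absurd hu.2 this.not_gt

/-- Just after the greedy time the control has reached α. Superadditivity at such points u, followed
by u ↓ the greedy time, shows that each completed step uses up α of the total. -/
lemma IsRegularControl.threshold_add_le (hw : IsRegularControl w)
    (h : nextTime w α t a < t) : α + w (nextTime w α t a) t ≤ w a t := by
  have : (𝓝[>] nextTime w α t a).NeBot := nhdsGT_neBot_of_exists_gt ⟨t, h⟩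
  refine le_of_tendsto ((hw.right_lim _ _ h).const_add α) ?_
  filter_upwards [Ioo_mem_nhdsGT h] with u hu
  rcases infTime_lt_iff.1 hu.1 with h1 | ⟨y, ⟨hy1, hy2⟩, hy3⟩
  · exact absurd hu.2 h1.not_gt
  · have hsa : Superadd w := hw.superadditive
    calc α + w u t ≤ w a u + w u t := by
          gcongr
          exact hy2.trans (hsa.mono le_rfl hy1.le hy3.le)
      _ ≤ w a t := hw.superadditive _ _ _ (hy1.le.trans hy3.le) hu.2.le

lemma greedyTime_le (h : a ≤ t) (i : ℕ) : greedyTime w α a t i ≤ t := by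
  cases i with
  | zero => exact h
  | succ i => exact nextTime_le

lemma le_greedyTime (h : a ≤ t) (i : ℕ) : a ≤ greedyTime w α a t i := by
  induction i with
  | zero => exact le_rfl
  | succ i ih => exact ih.trans (le_nextTime (greedyTime_le h i))

lemma IsRegularControl.mul_le_of_greedyTime_lt (hw : IsRegularControl w) (h : a ≤ t) (i : ℕ)
    (hi : greedyTime w α a t i < t) : i * α + w (greedyTime w α a t i) t ≤ w a t := by
  induction i with
  | zero => simp [greedyTime]
  | succ i ih =>
    have hlt : greedyTime w α a t i < t :=
      (le_nextTime (greedyTime_le h i)).trans_lt hi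
    refine le_trans ?_ (ih hlt)
    push_cast
    rw [add_mul, one_mul, add_assoc]
    gcongr
    exact hw.threshold_add_le hi

lemma IsRegularControl.countN_ne_top (hw : IsRegularControl w) (h : a ≤ t) (hα : α ≠ 0) :
    countN w α a t ≠ ⊤ := by
  have hfin := hw.finite a t h
  obtain ⟨n, hn⟩ := ENNReal.exists_nat_mul_gt hα hfin
  refine ne_top_of_le_ne_top (ENat.natCast_ne_top n) (iSup₂_le fun i hi => ?_)
  by_contra hcon
  have hni : (n : ℝ≥0∞) ≤ i := by exact_mod_cast (not_le.1 hcon).le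
  have := hw.mul_le_of_greedyTime_lt h i hi
  exact absurd (hn.trans_le ((mul_le_mul_left hni α).trans (le_self_add.trans this))) (lt_irrefl _)

lemma greedyTime_countN {N : ℕ} (h : a ≤ t) (hN : countN w α a t = N) :
    greedyTime w α a t (N + 1) = t := by
  -- N is the last index before t, so the (N+1)-st greedy time is t and N + 1 intervals cover [a,t].
  refine le_antisymm (greedyTime_le h _) (le_of_not_gt fun hlt => ?_)
  have : ((N + 1 : ℕ) : ℕ∞) ≤ countN w α a t :=
    le_iSup₂ (f := fun (n : ℕ) (_ : greedyTime w α a t n < t) => (n : ℕ∞)) (N + 1) hlt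
  rw [hN] at this
  have : N + 1 ≤ N := by exact_mod_cast this
  omega

end Deterministic

/-! ### Conditional bounds and stopping times. -/

section Stochastic

variable {T : ℝ} {Ω : Type u} {mΩ : MeasurableSpace Ω} {E : Type v} [NormedAddCommGroup E]
  {P : Measure Ω} {𝓕 : Filtration (TimeSet T) mΩ} {V : TimeSet T → Ω → E}

/-- Both sides of the pointwise bound are m-measurable, so testing on events of m is enough. Later
arguments then need only integrals over events. -/
lemma essSup_condLExp_le_iff [IsProbabilityMeasure P] {m : MeasurableSpace Ω} (hm : m ≤ mΩ)
    {X : Ω → ℝ≥0∞} {c : ℝ≥0∞} :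
    essSup (condLExp m P X) P ≤ c ↔
      ∀ A, MeasurableSet[m] A → ∫⁻ ω in A, X ω ∂P ≤ c * P A := by
  constructor
  · intro h A hA
    rw [← setLIntegral_condLExp hm P X hA]
    calc ∫⁻ ω in A, condLExp m P X ω ∂P ≤ ∫⁻ _ in A, c ∂P := by
          refine lintegral_mono_ae (ae_restrict_of_ae ?_)
          filter_upwards [ENNReal.ae_le_essSup (μ := P) (condLExp m P X)] with ω hω
          exact hω.trans h
      _ = c * P A := by simp
  · intro h
    refine essSup_le_of_ae_le c (ae_le_of_ae_le_trim (hm := hm) ?_)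
    refine ae_le_of_forall_setLIntegral_le_of_sigmaFinite (measurable_condLExp m P X) ?_
    intro A hA _
    rw [setLIntegral_condLExp_trim hm P X hA]
    refine (h A hA).trans_eq ?_
    simp [trim_measurableSet_eq hm hA]

lemma rho_le_iff [IsProbabilityMeasure P] {s t : TimeSet T} {c : ℝ≥0∞} :
    rho P 𝓕 V s t ≤ c ↔ ∀ (σ τ : Ω → TimeSet T)
      (hσ : IsStoppingTime 𝓕 fun ω => (σ ω : WithTop (TimeSet T)))
      (_ : IsStoppingTime 𝓕 fun ω => (τ ω : WithTop (TimeSet T)))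
      (_ : ∀ ω, s ≤ σ ω ∧ σ ω ≤ τ ω ∧ τ ω ≤ t), ∀ A, MeasurableSet[hσ.measurableSpace] A →
        ∫⁻ ω in A, ‖V (τ ω) ω - leftLimit V (σ ω) ω‖ₑ ∂P ≤ c * P A := by
  simp only [rho, iSup_le_iff]
  refine forall_congr' fun σ => forall_congr' fun τ => forall_congr' fun hσ =>
    forall_congr' fun hτ => forall_congr' fun h => ?_
  exact essSup_condLExp_le_iff hσ.measurableSpace_le

lemma isStoppingTime_iff {τ : Ω → TimeSet T} :
    IsStoppingTime 𝓕 (fun ω => (τ ω : WithTop (TimeSet T))) ↔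
      ∀ t, MeasurableSet[𝓕 t] {ω | τ ω ≤ t} := by
  simp only [IsStoppingTime, WithTop.coe_le_coe]

/-- For a bounded stopping time, the requirement that A lie in the supremum of the filtration
follows from the condition at the bound v. -/
lemma measurableSet_iff_stopping {τ : Ω → TimeSet T}
    (hτ : IsStoppingTime 𝓕 (fun ω => (τ ω : WithTop (TimeSet T)))) {v : TimeSet T}
    (hv : ∀ ω, τ ω ≤ v) {A : Set Ω} :
    MeasurableSet[hτ.measurableSpace] A ↔ ∀ t, MeasurableSet[𝓕 t] (A ∩ {ω | τ ω ≤ t}) := by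
  rw [IsStoppingTime.measurableSet]
  simp only [WithTop.coe_le_coe]
  refine ⟨fun h => h.2, fun h => ⟨?_, h⟩⟩
  have := le_iSup 𝓕 v _ (h v)
  rwa [show {ω | τ ω ≤ v} = univ from eq_univ_of_forall hv, inter_univ] at this

/-- {τ ≤ t} is the intersection of {τ < q} over a countable dense set of q just above t, hence
belongs to 𝓕 j for every j > t; right-continuity of the filtration concludes. -/
lemma isStoppingTime_of_lt (h𝓕 : 𝓕.IsRightContinuous) {τ : Ω → TimeSet T} {v : TimeSet T}
    (hv : ∀ ω, τ ω ≤ v) (h : ∀ t, t ≤ v → MeasurableSet[𝓕 t] {ω | τ ω < t}) :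
    IsStoppingTime 𝓕 (fun ω => (τ ω : WithTop (TimeSet T))) := by
  rw [isStoppingTime_iff]
  intro t
  rcases le_or_gt v t with hvt | htv
  · rw [show {ω | τ ω ≤ t} = univ from eq_univ_of_forall fun ω => (hv ω).trans hvt]
    exact @MeasurableSet.univ Ω (𝓕 t)
  have hne : (𝓝[>] t).NeBot := nhdsGT_neBot_of_exists_gt ⟨v, htv⟩
  have heq : 𝓕 t = ⨅ j > t, 𝓕 j := by
    rw [← Filtration.rightCont_eq_of_neBot_nhdsGT, h𝓕.eq]
  rw [heq]
  simp only [MeasurableSpace.measurableSet_iInf]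
  intro j hj
  obtain ⟨D, hDc, hDd⟩ := TopologicalSpace.exists_countable_dense (TimeSet T)
  have hEq : {ω | τ ω ≤ t} = ⋂ q ∈ D ∩ Set.Ioo t (min j v), {ω | τ ω < q} := by
    ext ω
    simp only [mem_ofPred_eq, mem_iInter]
    refine ⟨fun h q hq => lt_of_le_of_lt h hq.2.1, fun h => ?_⟩
    by_contra hcon
    obtain ⟨q, hq, hq1, hq2⟩ := hDd.exists_between (lt_min (not_le.1 hcon) (lt_min hj htv))
    exact absurd (h q ⟨hq, hq1, hq2.trans_le (min_le_right _ _)⟩)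
      (not_lt.2 (hq2.le.trans (min_le_left _ _)))
  rw [hEq]
  refine MeasurableSet.biInter (hDc.mono inter_subset_left) fun q hq => ?_
  exact 𝓕.mono (hq.2.2.le.trans (min_le_left _ _)) _ (h q (hq.2.2.le.trans (min_le_right _ _)))

/-! ### Càdlàg paths -/

lemma IsCadlagPath.eventually_Ici {f : TimeSet T → E} (hf : IsCadlagPath f) (t : TimeSet T) :
    Tendsto f (𝓝[≥] t) (𝓝 (f t)) :=
  continuousWithinAt_Ioi_iff_Ici.1 (hf t).1

lemma tendsto_leftLimit {ω : Ω} (hf : IsCadlagPath fun t => V t ω) {t x : TimeSet T} (h : x < t) :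
    Tendsto (fun s => V s ω) (𝓝[<] t) (𝓝 (leftLimit V t ω)) := by
  have : (𝓝[<] t).NeBot := nhdsLT_neBot_of_exists_lt ⟨x, h⟩
  obtain ⟨l, hl⟩ := (hf t).2
  rw [leftLimit, leftLim_eq_of_tendsto hl]
  exact hl

/-! ### Hitting times -/

/-- The times in `[u,v]` at which the path has moved by more than `c` since time `u`. -/
def exceedSet (V : TimeSet T → Ω → E) (u v : TimeSet T) (c : ℝ≥0∞) (ω : Ω) : Set (TimeSet T) :=
  {y | u ≤ y ∧ y ≤ v ∧ c < ‖V y ω - V u ω‖ₑ}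

/-- The first time in `[u,v]` at which the path has moved by more than `c` since time `u`. -/
def hit (V : TimeSet T → Ω → E) (u v : TimeSet T) (c : ℝ≥0∞) (ω : Ω) : TimeSet T :=
  infTime v (exceedSet V u v c ω)

/-- The event that the path moves by more than `c` in `[u,v]`. -/
def exceedEvent (V : TimeSet T → Ω → E) (u v : TimeSet T) (c : ℝ≥0∞) : Set Ω :=
  {ω | (exceedSet V u v c ω).Nonempty}

/-- `sup_{y ∈ [u,v]} |V_y - V_u|`. -/
def maxIncr (V : TimeSet T → Ω → E) (u v : TimeSet T) (ω : Ω) : ℝ≥0∞ :=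
  ⨆ y ∈ Set.Icc u v, ‖V y ω - V u ω‖ₑ

lemma lt_maxIncr_iff {u v : TimeSet T} {c : ℝ≥0∞} {ω : Ω} :
    c < maxIncr V u v ω ↔ ω ∈ exceedEvent V u v c := by
  simp only [maxIncr, lt_iSup_iff, exceedEvent, mem_ofPred_eq, exceedSet, Set.Nonempty, mem_Icc]
  exact exists_congr fun y => by tauto

lemma le_maxIncr {u v y : TimeSet T} (hy : y ∈ Set.Icc u v) (ω : Ω) :
    ‖V y ω - V u ω‖ₑ ≤ maxIncr V u v ω :=
  le_iSup₂ (α := ℝ≥0∞) (f := fun y (_ : y ∈ Set.Icc u v) => ‖V y ω - V u ω‖ₑ) y hy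

lemma exceedEvent_anti {u v : TimeSet T} {c c' : ℝ≥0∞} (h : c ≤ c') :
    exceedEvent V u v c' ⊆ exceedEvent V u v c :=
  fun _ ⟨y, h1, h2, h3⟩ => ⟨y, h1, h2, h.trans_lt h3⟩

lemma hit_le (u v : TimeSet T) (c : ℝ≥0∞) (ω : Ω) : hit V u v c ω ≤ v := infTime_le _ _

lemma le_hit {u v : TimeSet T} (huv : u ≤ v) (c : ℝ≥0∞) (ω : Ω) : u ≤ hit V u v c ω :=
  le_infTime_iff.2 ⟨huv, fun _ hy => hy.1⟩

lemma hit_mono {u v : TimeSet T} {c c' : ℝ≥0∞} (h : c ≤ c') (ω : Ω) :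
    hit V u v c ω ≤ hit V u v c' ω :=
  le_infTime_iff.2 ⟨infTime_le _ _, fun _ hy =>
    infTime_le_of_mem ⟨hy.1, hy.2.1, h.trans_lt hy.2.2⟩⟩

lemma enorm_le_of_lt_hit {u v y : TimeSet T} {c : ℝ≥0∞} {ω : Ω} (h1 : u ≤ y)
    (h2 : y < hit V u v c ω) : ‖V y ω - V u ω‖ₑ ≤ c := by
  by_contra hcon
  exact absurd (infTime_le_of_mem ⟨h1, h2.le.trans (hit_le u v c ω), not_le.1 hcon⟩ :
    hit V u v c ω ≤ y) h2.not_ge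

/-- Were the displacement below c at the hitting time, right-continuity would keep it below c a
little longer, contradicting that exceeding times accumulate there or attain it. -/
lemma le_enorm_hit {u v : TimeSet T} {c : ℝ≥0∞} {ω : Ω} (hf : IsCadlagPath fun t => V t ω)
    (h : ω ∈ exceedEvent V u v c) : c ≤ ‖V (hit V u v c ω) ω - V u ω‖ₑ := by
  by_contra hcon
  rw [not_le] at hcon
  have hlim : Tendsto (fun y => ‖V y ω - V u ω‖ₑ) (𝓝[≥] hit V u v c ω)
      (𝓝 ‖V (hit V u v c ω) ω - V u ω‖ₑ) :=
    ((hf.eventually_Ici _).sub_const _).enorm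
  have hev := hlim.eventually_lt_const hcon
  obtain ⟨y, hy⟩ := h
  have hle : hit V u v c ω ≤ y := infTime_le_of_mem hy
  rcases hle.eq_or_lt with heq | hlt
  · rw [heq] at hcon
    exact absurd hy.2.2 hcon.not_gt
  · obtain ⟨z, hz1, hz2⟩ := (mem_nhdsGE_iff_exists_mem_Ioc_Ico_subset hlt).1 hev
    have hzv : z ≤ v := hz1.2.trans hy.2.1
    have hz1 : hit V u v c ω < z := hz1.1
    rcases infTime_lt_iff.1 hz1 with h1 | ⟨x, hx, hxz⟩
    · exact absurd h1 (not_lt.2 hzv)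
    · have : x ∈ Set.Ico (hit V u v c ω) z := ⟨infTime_le_of_mem hx, hxz⟩
      exact absurd hx.2.2 (not_lt.2 (le_of_lt (hz2 this)))

lemma mem_exceedEvent_of_hit_lt {u v : TimeSet T} {c : ℝ≥0∞} {ω : Ω} (h : hit V u v c ω < v) :
    ω ∈ exceedEvent V u v c := by
  rcases infTime_lt_iff.1 h with h1 | ⟨x, hx, -⟩
  · exact absurd h1 (lt_irrefl _)
  · exact ⟨x, hx⟩

lemma measurableSet_hit_lt (hV : ∀ ω, IsCadlagPath fun t => V t ω) (hA : StronglyAdapted 𝓕 V)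
    {u v x : TimeSet T} (c : ℝ≥0∞) (hxv : x ≤ v) :
    MeasurableSet[𝓕 x] {ω | hit V u v c ω < x} := by
  obtain ⟨D, hDc, hDd⟩ := TopologicalSpace.exists_countable_dense (TimeSet T)
  -- A strict exceedance persists to the right, so a countable dense set of times detects it.
  have hEq : {ω | hit V u v c ω < x} =
      ⋃ y ∈ D ∩ Set.Ico u x, {ω | c < ‖V y ω - V u ω‖ₑ} := by
    ext ω
    simp only [mem_ofPred_eq, mem_iUnion, exists_prop, hit, infTime_lt_iff]
    constructor
    · rintro (h | ⟨y, hy, hyx⟩)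
      · exact absurd hxv h.not_ge
      have hlim : Tendsto (fun y => ‖V y ω - V u ω‖ₑ) (𝓝[≥] y) (𝓝 ‖V y ω - V u ω‖ₑ) :=
        (((hV ω).eventually_Ici _).sub_const _).enorm
      have hev := hlim.eventually_const_lt hy.2.2
      obtain ⟨z, hz1, hz2⟩ := (mem_nhdsGE_iff_exists_Ico_subset' hyx).1 hev
      have hz1 : y < z := hz1
      obtain ⟨q, hq, hq1, hq2⟩ := hDd.exists_between (lt_min hz1 hyx)
      exact ⟨q, ⟨hq, hy.1.trans hq1.le, hq2.trans_le (min_le_right _ _)⟩,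
        hz2 ⟨hq1.le, hq2.trans_le (min_le_left _ _)⟩⟩
    · rintro ⟨y, hy, h⟩
      exact Or.inr ⟨y, ⟨hy.2.1, hy.2.2.le.trans hxv, h⟩, hy.2.2⟩
  rw [hEq]
  refine MeasurableSet.biUnion (hDc.mono inter_subset_left) fun y hy => ?_
  refine measurableSet_lt (@measurable_const _ _ _ (𝓕 x) _) ?_
  exact ((hA.stronglyMeasurable_le hy.2.2.le).sub
    (hA.stronglyMeasurable_le (hy.2.1.trans hy.2.2.le))).enorm

lemma isStoppingTime_hit (h𝓕 : 𝓕.IsRightContinuous) (hV : ∀ ω, IsCadlagPath fun t => V t ω)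
    (hA : StronglyAdapted 𝓕 V) (u v : TimeSet T) (c : ℝ≥0∞) :
    IsStoppingTime 𝓕 (fun ω => (hit V u v c ω : WithTop (TimeSet T))) :=
  isStoppingTime_of_lt h𝓕 (hit_le u v c) fun _ ht => measurableSet_hit_lt hV hA c ht

lemma measurableSet_exceedEvent (hV : ∀ ω, IsCadlagPath fun t => V t ω)
    (hA : StronglyAdapted 𝓕 V) {u v : TimeSet T} (huv : u ≤ v) (c : ℝ≥0∞) :
    MeasurableSet[𝓕 v] (exceedEvent V u v c) := by
  -- The value v of `hit` also serves as the default when nothing exceeds c, so the endpoint is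
  -- tested separately.
  have hEq : exceedEvent V u v c = {ω | hit V u v c ω < v} ∪ {ω | c < ‖V v ω - V u ω‖ₑ} := by
    ext ω
    constructor
    · rintro ⟨y, hy⟩
      rcases hy.2.1.eq_or_lt with rfl | h
      · exact Or.inr hy.2.2
      · exact Or.inl (infTime_lt_iff.2 (Or.inr ⟨y, hy, h⟩))
    · rintro (h | h)
      · exact mem_exceedEvent_of_hit_lt h
      · exact ⟨v, huv, le_rfl, h⟩
  rw [hEq]
  refine (measurableSet_hit_lt hV hA c le_rfl).union ?_
  refine measurableSet_lt (@measurable_const _ _ _ (𝓕 v) _) ?_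
  exact ((hA v).sub (hA.stronglyMeasurable_le huv)).enorm

lemma measurable_maxIncr (hV : ∀ ω, IsCadlagPath fun t => V t ω)
    (hA : StronglyAdapted 𝓕 V) {u v : TimeSet T} (huv : u ≤ v) :
    Measurable[𝓕 v] (maxIncr V u v) := by
  refine @measurable_of_Ioi _ _ _ _ _ (𝓕 v) _ _ _ _ fun c => ?_
  have : maxIncr V u v ⁻¹' Set.Ioi c = exceedEvent V u v c := by
    ext ω
    exact lt_maxIncr_iff
  rw [this]
  exact measurableSet_exceedEvent hV hA huv c

/-- This makes the event an admissible test set for the conditional expectation at the hitting time.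
Before v, having hit already implies the event. -/
lemma measurableSet_inter_exceedEvent (h𝓕 : 𝓕.IsRightContinuous)
    (hV : ∀ ω, IsCadlagPath fun t => V t ω) (hA : StronglyAdapted 𝓕 V) {u v : TimeSet T}
    (huv : u ≤ v) (c : ℝ≥0∞) {B : Set Ω} (hB : MeasurableSet[𝓕 u] B) :
    MeasurableSet[(isStoppingTime_hit h𝓕 hV hA u v c).measurableSpace]
      (B ∩ exceedEvent V u v c) := by
  have hτ := isStoppingTime_hit h𝓕 hV hA u v c
  rw [measurableSet_iff_stopping hτ (hit_le u v c)]
  intro t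
  by_cases hut : u ≤ t
  swap
  · have : B ∩ exceedEvent V u v c ∩ {ω | hit V u v c ω ≤ t} = ∅ := by
      ext ω
      simp only [mem_inter_iff, mem_ofPred_eq, mem_empty_iff_false, iff_false, not_and]
      exact fun _ h => hut ((le_hit huv c ω).trans h)
    rw [this]
    exact @MeasurableSet.empty Ω (𝓕 t)
  have hB' := 𝓕.mono hut _ hB
  rcases le_or_gt v t with hvt | htv
  · exact (hB'.inter (𝓕.mono hvt _ (measurableSet_exceedEvent hV hA huv c))).inter
      (isStoppingTime_iff.1 hτ t)
  · have : B ∩ exceedEvent V u v c ∩ {ω | hit V u v c ω ≤ t} = B ∩ {ω | hit V u v c ω ≤ t} := by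
      ext ω
      simp only [mem_inter_iff, mem_ofPred_eq]
      exact ⟨fun h => ⟨h.1.1, h.2⟩,
        fun h => ⟨⟨h.1, mem_exceedEvent_of_hit_lt (h.2.trans_lt htv)⟩, h.2⟩⟩
    rw [this]
    exact hB'.inter (isStoppingTime_iff.1 hτ t)

/-! ### The John–Nirenberg inequality on a single interval -/

lemma enorm_leftLimit_hit_le (hV : ∀ ω, IsCadlagPath fun t => V t ω) {u v : TimeSet T}
    {c : ℝ≥0∞} (hc : 0 < c) {ω : Ω} (huv : u ≤ v) (h : ω ∈ exceedEvent V u v c) :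
    ‖leftLimit V (hit V u v c ω) ω - V u ω‖ₑ ≤ c := by
  have h1 : c ≤ ‖V (hit V u v c ω) ω - V u ω‖ₑ := le_enorm_hit (hV ω) h
  -- Positivity of c excludes a hit at u itself, where the left limit would see a jump prior to the
  -- increment from u.
  rcases (le_hit (V := V) huv c ω).eq_or_lt with heq | hlt
  · rw [← heq] at h1
    simp only [sub_self, enorm_zero] at h1
    exact absurd hc h1.not_gt
  have : (𝓝[<] hit V u v c ω).NeBot := nhdsLT_neBot_of_exists_lt ⟨u, hlt⟩
  refine le_of_tendsto (((tendsto_leftLimit (hV ω) hlt).sub_const (V u ω)).enorm) ?_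
  filter_upwards [Ioo_mem_nhdsLT hlt] with y hy
  exact enorm_le_of_lt_hit hy.1.le hy.2

/-- The two hitting times for c and c + a are used as σ and τ in ρ. Using the left limit at σ
prevents overshoot there, so the gain between the levels is at least a. -/
lemma exceedEvent_step [IsProbabilityMeasure P] (h𝓕 : 𝓕.IsRightContinuous)
    (hV : ∀ ω, IsCadlagPath fun t => V t ω) (hA : StronglyAdapted 𝓕 V) {u v : TimeSet T}
    (huv : u ≤ v) {c a κ : ℝ≥0∞} (hc : 0 < c) (hctop : c ≠ ∞) (hκ : rho P 𝓕 V u v ≤ κ)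
    {B : Set Ω} (hB : MeasurableSet[𝓕 u] B) :
    a * P (B ∩ exceedEvent V u v (c + a)) ≤ κ * P (B ∩ exceedEvent V u v c) := by
  have hle : c ≤ c + a := le_self_add
  refine le_trans ?_ (rho_le_iff.1 hκ (hit V u v c) (hit V u v (c + a))
    (isStoppingTime_hit h𝓕 hV hA u v c) (isStoppingTime_hit h𝓕 hV hA u v (c + a))
    (fun ω => ⟨le_hit huv c ω, hit_mono hle ω, hit_le _ _ _ _⟩) _
    (measurableSet_inter_exceedEvent h𝓕 hV hA huv c hB))
  have hsub : B ∩ exceedEvent V u v (c + a) ⊆ B ∩ exceedEvent V u v c :=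
    inter_subset_inter_right _ (exceedEvent_anti hle)
  refine le_trans ?_ (lintegral_mono_set hsub)
  have hm : MeasurableSet (B ∩ exceedEvent V u v (c + a)) :=
    (𝓕.le u _ hB).inter (𝓕.le v _ (measurableSet_exceedEvent hV hA huv _))
  rw [← setLIntegral_const]
  refine setLIntegral_mono' hm fun ω hω => ?_
  have h1 := le_enorm_hit (hV ω) hω.2
  have h2 := enorm_leftLimit_hit_le hV hc huv (hsub hω).2
  set x := V (hit V u v (c + a) ω) ω
  set y := leftLimit V (hit V u v c ω) ω
  have h3 : c + a ≤ c + ‖x - y‖ₑ :=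
    calc c + a ≤ ‖x - V u ω‖ₑ := h1
      _ = ‖(y - V u ω) + (x - y)‖ₑ := by congr 1; abel
      _ ≤ ‖y - V u ω‖ₑ + ‖x - y‖ₑ := enorm_add_le _ _
      _ ≤ c + ‖x - y‖ₑ := by gcongr
  exact (ENNReal.add_le_add_iff_left hctop).1 h3

/-- Iteration of `exceedEvent_step`. It starts from level a rather than 0 because that step needs a
positive level, so level (k+1)a carries only k factors θ. -/
lemma measure_exceedEvent_le [IsProbabilityMeasure P] (h𝓕 : 𝓕.IsRightContinuous)
    (hV : ∀ ω, IsCadlagPath fun t => V t ω) (hA : StronglyAdapted 𝓕 V) {u v : TimeSet T}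
    (huv : u ≤ v) {a θ : ℝ≥0∞} (ha : a ≠ 0) (hatop : a ≠ ∞) (hκ : rho P 𝓕 V u v ≤ a * θ)
    {B : Set Ω} (hB : MeasurableSet[𝓕 u] B) (k : ℕ) :
    P (B ∩ exceedEvent V u v ((k + 1) * a)) ≤ θ ^ k * P B := by
  induction k with
  | zero => simpa using measure_mono inter_subset_left
  | succ k ih =>
    have h := exceedEvent_step (a := a) h𝓕 hV hA huv (c := (k + 1) * a)
      (by positivity) (ENNReal.mul_ne_top (by finiteness) hatop) hκ hB
    rw [mul_assoc, ENNReal.mul_le_mul_iff_right ha hatop] at h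
    have e : ((k + 1 : ℕ) + 1 : ℝ≥0∞) * a = (k + 1) * a + a := by push_cast; ring
    rw [e]
    refine h.trans ?_
    rw [pow_succ', mul_assoc]
    gcongr

lemma le_tsum_exceed {g : ℝ≥0∞ → ℝ≥0∞} (hg : Monotone g) {a : ℝ≥0∞} (ha : a ≠ 0)
    (hatop : a ≠ ∞) (hga : g a ≠ 0) (u v : TimeSet T) (ω : Ω) :
    g (maxIncr V u v ω) ≤ g a + ∑' k : ℕ,
      (exceedEvent V u v ((k + 1) * a)).indicator (fun _ => g ((k + 2) * a)) ω := by
  set M := maxIncr V u v ω with hM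
  rcases le_or_gt M a with h | h
  · exact (hg h).trans le_self_add
  -- If the maximum is infinite, every term of the series is at least g(a) ≠ 0, so the series
  -- diverges. Otherwise the single layer (m+1)a < M ≤ (m+2)a is enough.
  by_cases htop : M = ∞
  · have h0 : ∀ k : ℕ, g a ≤
        (exceedEvent V u v ((k + 1) * a)).indicator (fun _ => g ((k + 2) * a)) ω := by
      intro k
      have : ω ∈ exceedEvent V u v ((k + 1) * a) := by
        rw [← lt_maxIncr_iff, ← hM, htop]
        exact (ENNReal.mul_ne_top (by finiteness) hatop).lt_top
      rw [indicator_of_mem this]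
      refine hg (le_trans (one_mul a).ge ?_)
      gcongr
      calc (1 : ℝ≥0∞) ≤ 2 := by norm_num
        _ ≤ k + 2 := le_add_self
    have : (∑' k : ℕ, (exceedEvent V u v ((k + 1) * a)).indicator
        (fun _ => g ((k + 2) * a)) ω) = ∞ := by
      refine top_le_iff.1 (le_trans ?_ (ENNReal.tsum_le_tsum h0))
      rw [ENNReal.tsum_const_eq_top_of_ne_zero hga]
    rw [this, add_top]
    exact le_top
  · obtain ⟨n, hn⟩ := ENNReal.exists_nat_mul_gt ha htop
    classical
    have hex : ∃ n : ℕ, M ≤ n * a := ⟨n, hn.le⟩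
    obtain ⟨m, hm⟩ : ∃ m, Nat.find hex = m + 2 := by
      have h2 := Nat.find_spec hex
      match hcase : Nat.find hex with
      | 0 => rw [hcase] at h2; simp at h2; simp [h2] at h
      | 1 => rw [hcase] at h2; simp at h2; exact absurd h2 h.not_ge
      | m + 2 => exact ⟨m, rfl⟩
    have h1 : M ≤ (m + 2) * a := by
      have := Nat.find_spec hex
      rw [hm] at this
      exact_mod_cast this
    have h2 : ω ∈ exceedEvent V u v ((m + 1) * a) := by
      rw [← lt_maxIncr_iff, ← hM]
      have := Nat.find_min hex (m := m + 1) (by omega)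
      exact_mod_cast not_le.1 this
    calc g M ≤ g ((m + 2) * a) := hg h1
      _ = (exceedEvent V u v ((m + 1) * a)).indicator (fun _ => g ((m + 2) * a)) ω := by
          rw [indicator_of_mem h2]
      _ ≤ _ := ENNReal.le_tsum (f := fun k : ℕ => (exceedEvent V u v ((k + 1) * a)).indicator
            (fun _ => g ((k + 2) * a)) ω) m
      _ ≤ _ := le_add_self

/-- The layer bound is integrated against the geometric tails. A general g serves both the
exponential moments and the q-th moments. -/
theorem johnNirenberg [IsProbabilityMeasure P] (h𝓕 : 𝓕.IsRightContinuous)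
    (hV : ∀ ω, IsCadlagPath fun t => V t ω) (hA : StronglyAdapted 𝓕 V) {u v : TimeSet T}
    (huv : u ≤ v) {a θ : ℝ≥0∞} (ha : a ≠ 0) (hatop : a ≠ ∞) (hκ : rho P 𝓕 V u v ≤ a * θ)
    {g : ℝ≥0∞ → ℝ≥0∞} (hg : Monotone g) (hga : g a ≠ 0)
    {B : Set Ω} (hB : MeasurableSet[𝓕 u] B) :
    ∫⁻ ω in B, g (maxIncr V u v ω) ∂P ≤
      (g a + ∑' k : ℕ, g ((k + 2) * a) * θ ^ k) * P B := by
  have hm (k : ℕ) : MeasurableSet (exceedEvent V u v ((k + 1) * a)) :=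
    𝓕.le v _ (measurableSet_exceedEvent hV hA huv _)
  calc ∫⁻ ω in B, g (maxIncr V u v ω) ∂P
      ≤ ∫⁻ ω in B, (g a + ∑' k : ℕ,
          (exceedEvent V u v ((k + 1) * a)).indicator (fun _ => g ((k + 2) * a)) ω) ∂P :=
        lintegral_mono fun ω => le_tsum_exceed hg ha hatop hga u v ω
    _ = g a * P B + ∑' k : ℕ, g ((k + 2) * a) * P (B ∩ exceedEvent V u v ((k + 1) * a)) := by
        rw [lintegral_add_left measurable_const, setLIntegral_const, lintegral_tsum]
        · congr 1
          refine tsum_congr fun k => ?_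
          rw [lintegral_indicator_const (hm k), Measure.restrict_apply (hm k), inter_comm]
        · exact fun k => (measurable_const.indicator (hm k)).aemeasurable
    _ ≤ g a * P B + ∑' k : ℕ, g ((k + 2) * a) * (θ ^ k * P B) := by
        gcongr with k
        exact measure_exceedEvent_le h𝓕 hV hA huv ha hatop hκ hB k
    _ = _ := by
        simp only [← mul_assoc]
        rw [ENNReal.tsum_mul_right, add_mul]

/-! ### Discretization of random times -/

/-- The `k`-th point of a grid of mesh `1 / (n + 1)`, capped at `v`. -/
def gridPoint (n : ℕ) (v : TimeSet T) (k : ℕ) : TimeSet T :=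
  ⟨min ((k : ℝ) / (n + 1)) v, le_min (by positivity) v.2.1, (min_le_right _ _).trans v.2.2⟩

/-- The first grid point after `x`, capped at `v`. -/
def roundUp (n : ℕ) (v x : TimeSet T) : TimeSet T := gridPoint n v (⌊((n : ℝ) + 1) * x⌋₊ + 1)

/-- The last grid point before `x`. -/
def roundDown (n : ℕ) (v x : TimeSet T) : TimeSet T := gridPoint n v (⌈((n : ℝ) + 1) * x⌉₊ - 1)

lemma gridPoint_le (n : ℕ) (v : TimeSet T) (k : ℕ) : gridPoint n v k ≤ v :=
  Subtype.coe_le_coe.1 (min_le_right _ _)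

lemma le_roundUp (n : ℕ) {v x : TimeSet T} (h : x ≤ v) : x ≤ roundUp n v x := by
  rw [← Subtype.coe_le_coe]
  refine le_min ?_ h
  rw [le_div_iff₀ (by positivity), mul_comm]
  push_cast
  exact (Nat.lt_floor_add_one _).le

lemma tendsto_inv_nat_add_one : Tendsto (fun n : ℕ => 1 / ((n : ℝ) + 1)) atTop (𝓝 0) :=
  tendsto_one_div_add_atTop_nhds_zero_nat

lemma tendsto_roundUp {v x : TimeSet T} (h : x ≤ v) :
    Tendsto (fun n => roundUp n v x) atTop (𝓝[≥] x) := by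
  refine tendsto_nhdsWithin_iff.2 ⟨?_, Eventually.of_forall fun n => le_roundUp n h⟩
  rw [tendsto_subtype_rng]
  have hlim : Tendsto (fun n : ℕ => (x : ℝ) + 1 / ((n : ℝ) + 1)) atTop (𝓝 ((x : ℝ) + 0)) :=
    tendsto_inv_nat_add_one.const_add _
  rw [add_zero] at hlim
  refine tendsto_of_tendsto_of_tendsto_of_le_of_le tendsto_const_nhds hlim
    (fun n => Subtype.coe_le_coe.2 (le_roundUp n h)) fun n => ?_
  refine (min_le_left _ _).trans ?_
  rw [div_le_iff₀ (by positivity)]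
  push_cast
  have h1 := Nat.floor_le (show 0 ≤ ((n : ℝ) + 1) * x from mul_nonneg (by positivity) x.2.1)
  have h2 : ((x : ℝ) + 1 / ((n : ℝ) + 1)) * (n + 1) = (n + 1) * x + 1 := by field_simp
  linarith

/-- Truncated subtraction keeps the index at 0, in agreement with V_{0-} = V_0. -/
lemma roundDown_of_eq_zero (n : ℕ) {v x : TimeSet T} (h : (x : ℝ) = 0) : roundDown n v x = x := by
  apply Subtype.ext
  simp [roundDown, gridPoint, h, v.2.1]

lemma roundDown_lt (n : ℕ) {v x : TimeSet T} (h : 0 < (x : ℝ)) : roundDown n v x < x := by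
  rw [← Subtype.coe_lt_coe]
  refine (min_le_left _ _).trans_lt ?_
  rw [div_lt_iff₀ (by positivity)]
  have hpos : 0 < ((n : ℝ) + 1) * x := by positivity
  have h1 := Nat.ceil_lt_add_one hpos.le
  have h2 : 1 ≤ ⌈((n : ℝ) + 1) * x⌉₊ := Nat.one_le_ceil_iff.2 hpos
  rw [Nat.cast_sub h2]
  push_cast
  linarith

lemma tendsto_roundDown {v x : TimeSet T} (h : x ≤ v) (hx : 0 < (x : ℝ)) :
    Tendsto (fun n => roundDown n v x) atTop (𝓝[<] x) := by
  refine tendsto_nhdsWithin_iff.2 ⟨?_, Eventually.of_forall fun n => roundDown_lt n hx⟩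
  rw [tendsto_subtype_rng]
  have hlim : Tendsto (fun n : ℕ => (x : ℝ) - 1 / ((n : ℝ) + 1)) atTop (𝓝 ((x : ℝ) - 0)) :=
    tendsto_inv_nat_add_one.const_sub _
  rw [sub_zero] at hlim
  refine tendsto_of_tendsto_of_tendsto_of_le_of_le hlim tendsto_const_nhds
    (fun n => ?_) fun n => Subtype.coe_le_coe.2 (roundDown_lt n hx).le
  have hn : 0 < 1 / ((n : ℝ) + 1) := by positivity
  have hv : (x : ℝ) ≤ v := h
  refine le_min ?_ (by linarith)
  rw [le_div_iff₀ (by positivity)]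
  have hpos : 0 < ((n : ℝ) + 1) * x := by positivity
  have h2 : 1 ≤ ⌈((n : ℝ) + 1) * x⌉₊ := Nat.one_le_ceil_iff.2 hpos
  rw [Nat.cast_sub h2]
  have h1 := Nat.le_ceil (((n : ℝ) + 1) * x)
  have h3 : ((x : ℝ) - 1 / ((n : ℝ) + 1)) * (n + 1) = (n + 1) * x - 1 := by field_simp
  push_cast
  linarith

lemma tendsto_leftLimit_roundDown {ω : Ω} (hf : IsCadlagPath fun t => V t ω) {v x : TimeSet T}
    (h : x ≤ v) : Tendsto (fun n => V (roundDown n v x) ω) atTop (𝓝 (leftLimit V x ω)) := by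
  rcases x.2.1.eq_or_lt with h0 | h0
  · have : leftLimit V x ω = V x ω := leftLim_eq_of_isBot fun y => Subtype.coe_le_coe.1
      (h0.symm.le.trans y.2.1)
    simp only [roundDown_of_eq_zero _ h0.symm, this]
    exact tendsto_const_nhds
  · have hx : (⟨0, le_rfl, x.2.1.trans x.2.2⟩ : TimeSet T) < x := h0
    exact (tendsto_leftLimit hf hx).comp (tendsto_roundDown h h0)

lemma tendsto_roundUp_path {ω : Ω} (hf : IsCadlagPath fun t => V t ω) {v x : TimeSet T}
    (h : x ≤ v) : Tendsto (fun n => V (roundUp n v x) ω) atTop (𝓝 (V x ω)) :=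
  (hf.eventually_Ici x).comp (tendsto_roundUp h)

lemma measurable_countable_index {m : MeasurableSpace Ω} {ι : Type*} [Countable ι]
    [MeasurableSpace ι] [MeasurableSingletonClass ι] {N : Ω → ι} (hN : Measurable[m] N)
    {f : ι → Ω → ℝ≥0∞} (hf : ∀ k, Measurable[m] (f k)) : Measurable[m] fun ω => f (N ω) ω :=
  (measurable_from_prod_countable_right (f := fun x : ι × Ω => f x.1 x.2) hf).comp
    (hN.prodMk measurable_id)

lemma measurable_floorIdx {m : MeasurableSpace Ω} {τ : Ω → TimeSet T} (hτ : Measurable[m] τ)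
    (n : ℕ) : Measurable[m] fun ω => ⌊((n : ℝ) + 1) * τ ω⌋₊ + 1 :=
  ((hτ.subtype_val.const_mul _).nat_floor).add_const 1

lemma measurable_ceilIdx {m : MeasurableSpace Ω} {τ : Ω → TimeSet T} (hτ : Measurable[m] τ)
    (n : ℕ) : Measurable[m] fun ω => ⌈((n : ℝ) + 1) * τ ω⌉₊ - 1 :=
  ((hτ.subtype_val.const_mul _).nat_ceil).sub_const 1

lemma measurable_enorm_jump {m : MeasurableSpace Ω} {τ : Ω → TimeSet T} (hτ : Measurable[m] τ)
    {v : TimeSet T} (hv : ∀ ω, τ ω ≤ v) (hm : ∀ s ≤ v, StronglyMeasurable[m] (V s))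
    (hV : ∀ ω, IsCadlagPath fun t => V t ω) :
    Measurable[m] fun ω => ‖V (τ ω) ω - leftLimit V (τ ω) ω‖ₑ := by
  refine measurable_of_tendsto_metrizable (f := fun n ω =>
    ‖V (roundUp n v (τ ω)) ω - V (roundDown n v (τ ω)) ω‖ₑ) (fun n => ?_) ?_
  · exact measurable_countable_index (f := fun (k : ℕ × ℕ) ω =>
      ‖V (gridPoint n v k.1) ω - V (gridPoint n v k.2) ω‖ₑ)
      ((measurable_floorIdx hτ n).prodMk (measurable_ceilIdx hτ n))
      fun k => ((hm _ (gridPoint_le _ _ _)).sub (hm _ (gridPoint_le _ _ _))).enorm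
  · rw [tendsto_pi_nhds]
    exact fun ω => ((tendsto_roundUp_path (hV ω) (hv ω)).sub
      (tendsto_leftLimit_roundDown (hV ω) (hv ω))).enorm

lemma measurable_min_stopping {σ : Ω → TimeSet T}
    (hσ : IsStoppingTime 𝓕 fun ω => (σ ω : WithTop (TimeSet T))) (t : TimeSet T) :
    Measurable[𝓕 t] fun ω => min (σ ω) t := by
  refine @measurable_of_Iic _ _ _ _ _ (𝓕 t) _ _ _ _ fun x => ?_
  rcases le_or_gt t x with h | h
  · have : (fun ω => min (σ ω) t) ⁻¹' Set.Iic x = univ := by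
      ext ω
      simp [h]
    rw [this]
    exact @MeasurableSet.univ Ω (𝓕 t)
  · have : (fun ω => min (σ ω) t) ⁻¹' Set.Iic x = {ω | σ ω ≤ x} := by
      ext ω
      simp [h.not_ge]
    rw [this]
    exact 𝓕.mono h.le _ (isStoppingTime_iff.1 hσ x)

/-! ### Jumps at stopping times -/

/-- Take τ = σ in ρ: the jump at σ is known at time σ, so the conditional expectation disappears.
Its measurability is checked on {σ ≤ x}, where σ agrees with σ ∧ x. -/
lemma ae_enorm_jump_le_rho [IsProbabilityMeasure P] (hV : ∀ ω, IsCadlagPath fun t => V t ω)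
    (hA : StronglyAdapted 𝓕 V) {s t : TimeSet T} {σ : Ω → TimeSet T}
    (hσ : IsStoppingTime 𝓕 fun ω => (σ ω : WithTop (TimeSet T)))
    (h : ∀ ω, s ≤ σ ω ∧ σ ω ≤ t) : ∀ᵐ ω ∂P, ‖jump V (σ ω) ω‖ₑ ≤ rho P 𝓕 V s t := by
  have hmeas : Measurable[hσ.measurableSpace]
      fun ω => ‖V (σ ω) ω - leftLimit V (σ ω) ω‖ₑ := by
    intro B hB
    rw [measurableSet_iff_stopping hσ (fun ω => (h ω).2)]
    intro x
    have hx := measurable_enorm_jump (measurable_min_stopping hσ x)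
      (fun ω => min_le_right _ _) (fun s hs => hA.stronglyMeasurable_le hs) hV hB
    convert hx.inter (isStoppingTime_iff.1 hσ x) using 1
    ext ω
    simp only [mem_inter_iff, mem_preimage, mem_ofPred_eq, and_congr_left_iff]
    intro hω
    rw [min_eq_left hω]
  have hint := (essSup_condLExp_le_iff hσ.measurableSpace_le).2
    (rho_le_iff.1 (le_refl (rho P 𝓕 V s t)) σ σ hσ hσ fun ω => ⟨(h ω).1, le_rfl, (h ω).2⟩)
  rw [condLExp_eq_self hσ.measurableSpace_le P hmeas] at hint
  filter_upwards [ENNReal.ae_le_essSup (μ := P)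
    (fun ω => ‖V (σ ω) ω - leftLimit V (σ ω) ω‖ₑ)] with ω hω
  exact hω.trans hint

lemma isStoppingTime_const_coe (s : TimeSet T) :
    IsStoppingTime 𝓕 (fun _ : Ω => (s : WithTop (TimeSet T))) :=
  isStoppingTime_const 𝓕 s

/-- Every jump is found by one of countably many hitting times. -/
lemma exists_hit_eq {ω : Ω} (hf : IsCadlagPath fun t => V t ω) {D : Set (TimeSet T)}
    (hD : Dense D) {s t x : TimeSet T} (hsx : s < x) (hxt : x ≤ t) (hx : jump V x ω ≠ 0) :
    ∃ q ∈ D ∩ Set.Icc s t, ∃ n : ℕ, hit V q t ((n : ℝ≥0∞)⁻¹) ω = x := by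
  have hpos : ‖jump V x ω‖ₑ ≠ 0 := by simpa using hx
  obtain ⟨n, hn⟩ := ENNReal.exists_inv_nat_lt hpos
  have hlim := tendsto_leftLimit hf hsx
  -- Just left of x the path oscillates by less than 1/n, whereas the step from there to V_x exceeds
  -- 1/n. A hitting time at level 1/n started there therefore stops exactly at x.
  have h1 : Tendsto (fun z : TimeSet T × TimeSet T => ‖V z.1 ω - V z.2 ω‖ₑ)
      (𝓝[<] x ×ˢ 𝓝[<] x) (𝓝 ‖leftLimit V x ω - leftLimit V x ω‖ₑ) :=
    ((hlim.comp tendsto_fst).sub (hlim.comp tendsto_snd)).enorm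
  rw [sub_self, enorm_zero] at h1
  have h2 := h1.eventually_lt_const (show (0 : ℝ≥0∞) < (n : ℝ≥0∞)⁻¹ by simp)
  obtain ⟨S, hS, hS'⟩ := (eventually_prod_self_iff
    (r := fun a b => ‖V a ω - V b ω‖ₑ < (n : ℝ≥0∞)⁻¹)).1 h2
  have h3 : ∀ᶠ q in 𝓝[<] x, ((n : ℝ≥0∞)⁻¹) < ‖V x ω - V q ω‖ₑ :=
    ((hlim.const_sub _).enorm).eventually_const_lt hn
  obtain ⟨z, hz1, hz2⟩ := (mem_nhdsLT_iff_exists_Ioo_subset' hsx).1 (inter_mem hS h3)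
  obtain ⟨q, hq, hq1, hq2⟩ := hD.exists_between (max_lt hz1 hsx)
  have hzq : z < q := (le_max_left _ _).trans_lt hq1
  have hsq : s < q := (le_max_right _ _).trans_lt hq1
  refine ⟨q, ⟨hq, hsq.le, hq2.le.trans hxt⟩, n, le_antisymm ?_ ?_⟩
  · exact infTime_le_of_mem ⟨hq2.le, hxt, (hz2 ⟨hzq, hq2⟩).2⟩
  · refine le_infTime_iff.2 ⟨hxt, fun y hy => le_of_not_gt fun hyx => ?_⟩
    have := hS' y (hz2 ⟨hzq.trans_le hy.1, hyx⟩).1 q (hz2 ⟨hzq, hq2⟩).1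
    exact absurd hy.2.2 this.le.not_gt

lemma GamNorm_le_rho [IsProbabilityMeasure P] (h𝓕 : 𝓕.IsRightContinuous)
    (hV : ∀ ω, IsCadlagPath fun t => V t ω) (hA : StronglyAdapted 𝓕 V) {s t : TimeSet T}
    (hst : s ≤ t) : GamNorm P V s t ≤ rho P 𝓕 V s t := by
  obtain ⟨D, hDc, hDd⟩ := TopologicalSpace.exists_countable_dense (TimeSet T)
  refine essSup_le_of_ae_le _ ?_
  have h1 := ae_enorm_jump_le_rho (P := P) hV hA (isStoppingTime_const_coe s)
    (fun _ => ⟨le_rfl, hst⟩)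
  have h2 : ∀ᵐ ω ∂P, ∀ q ∈ D ∩ Set.Icc s t, ∀ n : ℕ,
      ‖jump V (hit V q t ((n : ℝ≥0∞)⁻¹) ω) ω‖ₑ ≤ rho P 𝓕 V s t := by
    rw [ae_ball_iff (hDc.mono inter_subset_left)]
    intro q hq
    rw [ae_all_iff]
    intro n
    exact ae_enorm_jump_le_rho hV hA (isStoppingTime_hit h𝓕 hV hA q t _)
      fun ω => ⟨hq.2.1.trans (le_hit hq.2.2 _ ω), hit_le _ _ _ _⟩
  filter_upwards [h1, h2] with ω hω1 hω2
  refine iSup₂_le fun x hx => ?_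
  rcases hx.1.eq_or_lt with rfl | hsx
  · exact hω1
  by_cases h0 : jump V x ω = 0
  · simp [h0]
  obtain ⟨q, hq, n, hn⟩ := exists_hit_eq (hV ω) hDd hsx hx.2 h0
  have := hω2 q hq n
  rwa [hn] at this

lemma ae_enorm_jump_le_GamNorm {s t : TimeSet T} :
    ∀ᵐ ω ∂P, ∀ x ∈ Set.Icc s t, ‖jump V x ω‖ₑ ≤ GamNorm P V s t := by
  filter_upwards [ENNReal.ae_le_essSup (μ := P) (Gam V s t)] with ω hω x hx
  exact le_trans (le_iSup₂ (α := ℝ≥0∞)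
    (f := fun u (_ : u ∈ Set.Icc s t) => ‖jump V u ω‖ₑ) x hx) hω

/-! ### Comparison of the modulus of mean variation with conditional norms -/

lemma condNorm_le_iff [IsProbabilityMeasure P] {q : ℝ} (hq : 1 ≤ q) {s t : TimeSet T}
    {c : ℝ≥0∞} : condNorm q P 𝓕 V s t ≤ c ↔ ∀ A, MeasurableSet[𝓕 s] A →
      ∫⁻ ω in A, ‖V t ω - V s ω‖ₑ ^ q ∂P ≤ c ^ q * P A := by
  rw [← essSup_condLExp_le_iff (𝓕.le s), condNorm, one_div,
    ENNReal.rpow_inv_le_iff (by linarith)]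

lemma lintegral_le_of_tendsto {μ : Measure Ω} {f : ℕ → Ω → ℝ≥0∞} {g : Ω → ℝ≥0∞} {c : ℝ≥0∞}
    (hf : ∀ n, AEMeasurable (f n) μ)
    (hlim : ∀ᵐ ω ∂μ, Tendsto (fun n => f n ω) atTop (𝓝 (g ω)))
    (h : ∀ᶠ n in atTop, ∫⁻ ω, f n ω ∂μ ≤ c) : ∫⁻ ω, g ω ∂μ ≤ c :=
  calc ∫⁻ ω, g ω ∂μ = ∫⁻ ω, liminf (fun n => f n ω) atTop ∂μ :=
        lintegral_congr_ae (hlim.mono fun _ hω => hω.liminf_eq.symm)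
    _ ≤ liminf (fun n => ∫⁻ ω, f n ω ∂μ) atTop := lintegral_liminf_le' hf
    _ ≤ c := liminf_le_of_frequently_le' h.frequently

/-- Fatou along x ↓ s, using right-continuity of V and that events known at s are known at x. It
provides the hypothesis of `pVarIco_rpow`. -/
lemma condNorm_le_iSup [IsProbabilityMeasure P] (hV : ∀ ω, IsCadlagPath fun t => V t ω)
    (hA : StronglyAdapted 𝓕 V) (s t : TimeSet T) (hst : s < t) :
    condNorm 1 P 𝓕 V s t ≤ ⨆ x ∈ Set.Ioo s t, condNorm 1 P 𝓕 V x t := by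
  have hne : (𝓝[>] s).NeBot := nhdsGT_neBot_of_exists_gt ⟨t, hst⟩
  obtain ⟨x, hx⟩ := (𝓝[>] s).exists_seq_tendsto
  rw [condNorm_le_iff le_rfl]
  intro A hAs
  refine lintegral_le_of_tendsto (f := fun n ω => ‖V t ω - V (x n) ω‖ₑ ^ (1 : ℝ))
    (fun n => ?_) (Eventually.of_forall fun ω => ?_) ?_
  · exact (((hA.stronglyMeasurable.sub hA.stronglyMeasurable).enorm).pow_const _).aemeasurable
  · simp only [ENNReal.rpow_one]
    exact (((hV ω s).1.tendsto.comp hx).const_sub _).enorm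
  · filter_upwards [hx.eventually (Ioo_mem_nhdsGT hst)] with n hn
    exact condNorm_le_iff le_rfl |>.1 (le_iSup₂ (α := ℝ≥0∞)
      (f := fun x (_ : x ∈ Set.Ioo s t) => condNorm 1 P 𝓕 V x t) (x n) hn) A
      (𝓕.mono hn.1.le _ hAs)

lemma measurable_enorm_roundUp (hA : StronglyAdapted 𝓕 V) {σ : Ω → TimeSet T}
    (hσ : Measurable σ) (n : ℕ) (v : TimeSet T) :
    Measurable fun ω => ‖V v ω - V (roundUp n v (σ ω)) ω‖ₑ :=
  measurable_countable_index (f := fun (k : ℕ) ω => ‖V v ω - V (gridPoint n v k) ω‖ₑ)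
    (measurable_floorIdx hσ n) fun _ => (hA.stronglyMeasurable.sub hA.stronglyMeasurable).enorm

lemma measurable_stopping {σ : Ω → TimeSet T}
    (hσ : IsStoppingTime 𝓕 fun ω => (σ ω : WithTop (TimeSet T))) {v : TimeSet T}
    (hv : ∀ ω, σ ω ≤ v) : Measurable σ := by
  have h := (measurable_min_stopping hσ v).mono (𝓕.le v) le_rfl
  simpa only [min_eq_left (hv _)] using h

/-- The rounded time takes countably many values. Where it equals a given grid point, σ has already
occurred, so that piece of A is known at the grid point and the deterministic-time bound applies. -/
lemma lintegral_enorm_roundUp_le [IsProbabilityMeasure P]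
    {u v : TimeSet T} {c : ℝ≥0∞}
    (hc : ∀ x ∈ Set.Icc u v, condNorm 1 P 𝓕 V x v ≤ c) {σ : Ω → TimeSet T}
    (hσ : IsStoppingTime 𝓕 fun ω => (σ ω : WithTop (TimeSet T)))
    (h : ∀ ω, u ≤ σ ω ∧ σ ω ≤ v) {A : Set Ω} (hAσ : MeasurableSet[hσ.measurableSpace] A) (n : ℕ) :
    ∫⁻ ω in A, ‖V v ω - V (roundUp n v (σ ω)) ω‖ₑ ∂P ≤ c * P A := by
  set N : Ω → ℕ := fun ω => ⌊((n : ℝ) + 1) * σ ω⌋₊ + 1 with hN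
  have hNm : Measurable N := measurable_floorIdx (measurable_stopping hσ fun ω => (h ω).2) n
  have hAm : MeasurableSet A := hσ.measurableSpace_le _ hAσ
  have hAu : A = ⋃ k, A ∩ N ⁻¹' {k} := by
    ext ω
    simp
  have hmk (k : ℕ) : MeasurableSet (A ∩ N ⁻¹' {k}) := hAm.inter (hNm (measurableSet_singleton k))
  have hd : Pairwise (Function.onFun Disjoint fun k => A ∩ N ⁻¹' {k}) := by
    intro i j hij
    refine Set.disjoint_left.2 fun ω h1 h2 => hij ?_
    exact (h1.2 : N ω = i).symm.trans h2.2
  have hP : P A = ∑' k, P (A ∩ N ⁻¹' {k}) := by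
    conv_lhs => rw [hAu]
    exact measure_iUnion hd hmk
  rw [hP, ← ENNReal.tsum_mul_left]
  conv_lhs => rw [hAu]
  rw [lintegral_iUnion hmk hd]
  refine ENNReal.tsum_le_tsum fun k => ?_
  rcases (A ∩ N ⁻¹' {k}).eq_empty_or_nonempty with hemp | ⟨ω₀, hω₀⟩
  · simp [hemp]
  have hrd (ω : Ω) (hω : ω ∈ A ∩ N ⁻¹' {k}) : roundUp n v (σ ω) = gridPoint n v k :=
    congr_arg (gridPoint n v) hω.2
  have hle (ω : Ω) (hω : ω ∈ A ∩ N ⁻¹' {k}) : σ ω ≤ gridPoint n v k := by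
    rw [← hrd ω hω]
    exact le_roundUp n (h ω).2
  have hmem : gridPoint n v k ∈ Set.Icc u v :=
    ⟨(h ω₀).1.trans (hle ω₀ hω₀), gridPoint_le _ _ _⟩
  have hmg : MeasurableSet[𝓕 (gridPoint n v k)] (A ∩ N ⁻¹' {k}) := by
    have h1 := (measurableSet_iff_stopping hσ (fun ω => (h ω).2)).1 hAσ (gridPoint n v k)
    have h2 := measurable_floorIdx (measurable_min_stopping hσ (gridPoint n v k)) n
      (measurableSet_singleton k)
    convert h1.inter h2 using 1
    ext ω
    simp only [mem_inter_iff, mem_preimage, mem_singleton_iff, mem_ofPred_eq, hN]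
    constructor
    · intro hω
      have := hle ω ⟨hω.1, hω.2⟩
      exact ⟨⟨hω.1, this⟩, by rw [min_eq_left this]; exact hω.2⟩
    · rintro ⟨⟨h3, h4⟩, h5⟩
      rw [min_eq_left h4] at h5
      exact ⟨h3, h5⟩
  have := (condNorm_le_iff le_rfl).1 (hc _ hmem) _ hmg
  simp only [ENNReal.rpow_one] at this
  refine le_trans (le_of_eq ?_) this
  exact setLIntegral_congr_fun (hmk k) fun ω hω => by rw [hrd ω hω]

/-- V_τ and V_σ are both compared with the terminal value V_v, at cost c each, and the jump at σ
costs ‖Γ‖. Random times are reached from grid times on their right by Fatou. -/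
lemma rho_le_of_condNorm [IsProbabilityMeasure P] (hV : ∀ ω, IsCadlagPath fun t => V t ω)
    (hA : StronglyAdapted 𝓕 V) {u v : TimeSet T} {c : ℝ≥0∞}
    (hc : ∀ x ∈ Set.Icc u v, condNorm 1 P 𝓕 V x v ≤ c) :
    rho P 𝓕 V u v ≤ 2 * c + GamNorm P V u v := by
  rw [rho_le_iff]
  intro σ τ hσ hτ h A hAσ
  have hAτ : MeasurableSet[hτ.measurableSpace] A :=
    hσ.measurableSpace_mono hτ (fun ω => WithTop.coe_le_coe.2 (h ω).2.1) _ hAσ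
  have hσ' : ∀ ω, u ≤ σ ω ∧ σ ω ≤ v := fun ω => ⟨(h ω).1, (h ω).2.1.trans (h ω).2.2⟩
  have hτ' : ∀ ω, u ≤ τ ω ∧ τ ω ≤ v := fun ω => ⟨(h ω).1.trans (h ω).2.1, (h ω).2.2⟩
  have hmσ := measurable_stopping hσ fun ω => (hσ' ω).2
  have hmτ := measurable_stopping hτ fun ω => (hτ' ω).2
  have key : ∫⁻ ω in A, (‖V v ω - V (τ ω) ω‖ₑ + ‖V v ω - V (σ ω) ω‖ₑ) ∂P ≤ 2 * c * P A := by
    refine lintegral_le_of_tendsto (f := fun n ω => ‖V v ω - V (roundUp n v (τ ω)) ω‖ₑ +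
      ‖V v ω - V (roundUp n v (σ ω)) ω‖ₑ) (fun n => ?_) (Eventually.of_forall fun ω => ?_)
      (Eventually.of_forall fun n => ?_)
    · exact ((measurable_enorm_roundUp hA hmτ n v).add
        (measurable_enorm_roundUp hA hmσ n v)).aemeasurable
    · exact ((tendsto_roundUp_path (hV ω) (hτ' ω).2).const_sub _).enorm.add
        ((tendsto_roundUp_path (hV ω) (hσ' ω).2).const_sub _).enorm
    · rw [lintegral_add_left (measurable_enorm_roundUp hA hmτ n v), mul_assoc, two_mul]
      exact add_le_add (lintegral_enorm_roundUp_le hc hτ hτ' hAτ n)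
        (lintegral_enorm_roundUp_le hc hσ hσ' hAσ n)
  calc ∫⁻ ω in A, ‖V (τ ω) ω - leftLimit V (σ ω) ω‖ₑ ∂P
      ≤ ∫⁻ ω in A, ((‖V v ω - V (τ ω) ω‖ₑ + ‖V v ω - V (σ ω) ω‖ₑ) + GamNorm P V u v) ∂P := by
        refine lintegral_mono_ae (ae_restrict_of_ae ?_)
        filter_upwards [ae_enorm_jump_le_GamNorm (P := P) (V := V) (s := u) (t := v)] with ω hω
        calc ‖V (τ ω) ω - leftLimit V (σ ω) ω‖ₑ
            = ‖(-(V v ω - V (τ ω) ω) + (V v ω - V (σ ω) ω)) + jump V (σ ω) ω‖ₑ := by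
              congr 1
              simp only [jump]
              abel
          _ ≤ ‖-(V v ω - V (τ ω) ω) + (V v ω - V (σ ω) ω)‖ₑ + ‖jump V (σ ω) ω‖ₑ :=
              enorm_add_le _ _
          _ ≤ (‖-(V v ω - V (τ ω) ω)‖ₑ + ‖V v ω - V (σ ω) ω‖ₑ) + GamNorm P V u v :=
              add_le_add (enorm_add_le _ _) (hω _ (hσ' ω))
          _ = _ := by rw [enorm_neg]
    _ = ∫⁻ ω in A, (‖V v ω - V (τ ω) ω‖ₑ + ‖V v ω - V (σ ω) ω‖ₑ) ∂P + GamNorm P V u v * P A := by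
        rw [lintegral_add_right _ measurable_const, setLIntegral_const]
    _ ≤ 2 * c * P A + GamNorm P V u v * P A := by gcongr
    _ = _ := by rw [add_mul]

end Stochastic

/-! ### Exponential moments and their concatenation. -/

/-- The exponential function on `[0,∞]`. -/
def expE (x : ℝ≥0∞) : ℝ≥0∞ := EReal.exp (x : EReal)

lemma expE_mono : Monotone expE := fun _ _ h =>
  EReal.exp_monotone (EReal.coe_ennreal_le_coe_ennreal_iff.2 h)

lemma expE_zero : expE 0 = 1 := by simp [expE]

lemma one_le_expE (x : ℝ≥0∞) : 1 ≤ expE x := expE_zero.ge.trans (expE_mono zero_le)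

lemma expE_add (x y : ℝ≥0∞) : expE (x + y) = expE x * expE y := by
  rw [expE, EReal.coe_ennreal_add, EReal.exp_add, expE, expE]

lemma expE_nat_mul (n : ℕ) (x : ℝ≥0∞) : expE (n * x) = expE x ^ n := by
  induction n with
  | zero => simp [expE_zero]
  | succ n ih =>
    push_cast
    rw [add_mul, one_mul, expE_add, ih, pow_succ]

lemma expE_ofReal {x : ℝ} (hx : 0 ≤ x) : expE (ENNReal.ofReal x) = ENNReal.ofReal (Real.exp x) := by
  rw [expE, EReal.coe_ennreal_ofReal, max_eq_left hx, EReal.exp_coe]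

lemma continuous_expE_mul (lam : ℝ) : Continuous fun x => expE (ENNReal.ofReal lam * x) :=
  ENNReal.continuous_exp.comp
    (continuous_coe_ennreal_ereal.comp (ENNReal.continuous_const_mul ENNReal.ofReal_ne_top))

lemma monotone_expE_mul (lam : ℝ) : Monotone fun x => expE (ENNReal.ofReal lam * x) :=
  fun _ _ h => expE_mono (by gcongr)

section Stochastic

variable {T : ℝ} {Ω : Type u} {mΩ : MeasurableSpace Ω} {E : Type v} [NormedAddCommGroup E]
  {P : Measure Ω} {𝓕 : Filtration (TimeSet T) mΩ} {V : TimeSet T → Ω → E}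

/-- `‖𝔼_s exp (lam * sup_{y ∈ [s,t]} |V_y - V_s|)‖_∞ ≤ K`. -/
def ExpLe (lam : ℝ) (P : Measure Ω) (𝓕 : Filtration (TimeSet T) mΩ) (V : TimeSet T → Ω → E)
    (s t : TimeSet T) (K : ℝ≥0∞) : Prop :=
  ∀ B, MeasurableSet[𝓕 s] B →
    ∫⁻ ω in B, expE (ENNReal.ofReal lam * maxIncr V s t ω) ∂P ≤ K * P B

lemma ExpLe.mono {lam : ℝ} {s t : TimeSet T} {K K' : ℝ≥0∞} (h : ExpLe lam P 𝓕 V s t K)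
    (hK : K ≤ K') : ExpLe lam P 𝓕 V s t K' :=
  fun B hB => (h B hB).trans (mul_le_mul_left hK _)

lemma expLe_self (lam : ℝ) (P : Measure Ω) (𝓕 : Filtration (TimeSet T) mΩ)
    (V : TimeSet T → Ω → E) (s : TimeSet T) : ExpLe lam P 𝓕 V s s 1 := by
  intro B _
  have : ∀ ω, maxIncr V s s ω = 0 := fun ω => by simp [maxIncr]
  simp [this, expE_zero]

/-- The tower property in integral form: on m, the measure with density Y is at most K times P, and
X is integrated against both. -/
lemma lintegral_mul_le_of_forall {m : MeasurableSpace Ω} (hm : m ≤ mΩ) {X Y : Ω → ℝ≥0∞}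
    (hX : Measurable[m] X) (hY : Measurable[mΩ] Y) {K : ℝ≥0∞}
    (h : ∀ A, MeasurableSet[m] A → ∫⁻ ω in A, Y ω ∂P ≤ K * P A) :
    ∫⁻ ω, X ω * Y ω ∂P ≤ K * ∫⁻ ω, X ω ∂P := by
  have hX' : Measurable[mΩ] X := hX.mono hm le_rfl
  have hle : (P.withDensity Y).trim hm ≤ K • P.trim hm := by
    refine Measure.le_iff.2 fun A hA => ?_
    rw [trim_measurableSet_eq hm hA, withDensity_apply _ (hm A hA), Measure.smul_apply,
      trim_measurableSet_eq hm hA, smul_eq_mul]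
    exact h A hA
  calc ∫⁻ ω, X ω * Y ω ∂P = ∫⁻ ω, X ω ∂(P.withDensity Y) := by
        rw [lintegral_withDensity_eq_lintegral_mul _ hY hX']
        simp only [Pi.mul_apply, mul_comm]
    _ = ∫⁻ ω, X ω ∂((P.withDensity Y).trim hm) := (lintegral_trim hm hX).symm
    _ ≤ ∫⁻ ω, X ω ∂(K • P.trim hm) := lintegral_mono' hle le_rfl
    _ = K * ∫⁻ ω, X ω ∂P := by rw [lintegral_smul_measure, lintegral_trim hm hX, smul_eq_mul]

lemma maxIncr_le_add (s m t : TimeSet T) (ω : Ω) (hsm : s ≤ m) :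
    maxIncr V s t ω ≤ maxIncr V s m ω + maxIncr V m t ω := by
  refine iSup₂_le fun y hy => ?_
  rcases le_total y m with h | h
  · exact (le_maxIncr ⟨hy.1, h⟩ ω).trans le_self_add
  · calc ‖V y ω - V s ω‖ₑ = ‖(V m ω - V s ω) + (V y ω - V m ω)‖ₑ := by congr 1; abel
      _ ≤ ‖V m ω - V s ω‖ₑ + ‖V y ω - V m ω‖ₑ := enorm_add_le _ _
      _ ≤ _ := add_le_add (le_maxIncr ⟨hsm, le_rfl⟩ ω) (le_maxIncr ⟨h, hy.2⟩ ω)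

lemma ExpLe.trans (hV : ∀ ω, IsCadlagPath fun t => V t ω) (hA : StronglyAdapted 𝓕 V) {lam : ℝ}
    {s m t : TimeSet T} (hsm : s ≤ m) (hmt : m ≤ t) {K K' : ℝ≥0∞}
    (h : ExpLe lam P 𝓕 V s m K) (h' : ExpLe lam P 𝓕 V m t K') :
    ExpLe lam P 𝓕 V s t (K * K') := by
  intro B hB
  have hmeas : ∀ {m : MeasurableSpace Ω} {X : Ω → ℝ≥0∞}, Measurable[m] X →
      Measurable[m] fun ω => expE (ENNReal.ofReal lam * X ω) :=
    fun hX => (continuous_expE_mul lam).measurable.comp hX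
  have hB' : MeasurableSet[𝓕 m] B := 𝓕.mono hsm _ hB
  have hX : Measurable[𝓕 m]
      (B.indicator fun ω => expE (ENNReal.ofReal lam * maxIncr V s m ω)) :=
    (hmeas (measurable_maxIncr hV hA hsm)).indicator hB'
  have hY : Measurable[mΩ] fun ω => expE (ENNReal.ofReal lam * maxIncr V m t ω) :=
    hmeas ((measurable_maxIncr hV hA hmt).mono (𝓕.le t) le_rfl)
  calc ∫⁻ ω in B, expE (ENNReal.ofReal lam * maxIncr V s t ω) ∂P
      ≤ ∫⁻ ω in B, expE (ENNReal.ofReal lam * maxIncr V s m ω) *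
          expE (ENNReal.ofReal lam * maxIncr V m t ω) ∂P := by
        refine lintegral_mono fun ω => ?_
        rw [← expE_add, ← mul_add]
        exact monotone_expE_mul lam (maxIncr_le_add s m t ω hsm)
    _ = ∫⁻ ω, B.indicator (fun ω => expE (ENNReal.ofReal lam * maxIncr V s m ω)) ω *
          expE (ENNReal.ofReal lam * maxIncr V m t ω) ∂P := by
        rw [← lintegral_indicator (𝓕.le s _ hB)]
        refine lintegral_congr fun ω => ?_
        by_cases hω : ω ∈ B <;> simp [hω]
    _ ≤ K' * ∫⁻ ω, B.indicator
          (fun ω => expE (ENNReal.ofReal lam * maxIncr V s m ω)) ω ∂P :=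
        lintegral_mul_le_of_forall (𝓕.le m) hX hY h'
    _ ≤ K' * (K * P B) := by
        rw [lintegral_indicator (𝓕.le s _ hB)]
        gcongr
        exact h B hB
    _ = _ := by ring

/-- The modulus of mean variation below which exponential moments of order `lam` exist. -/
def jnThreshold (lam : ℝ) : ℝ := Real.exp (-lam) / 2

lemma expLe_of_rho [IsProbabilityMeasure P] (h𝓕 : 𝓕.IsRightContinuous)
    (hV : ∀ ω, IsCadlagPath fun t => V t ω) (hA : StronglyAdapted 𝓕 V) {lam : ℝ} (hlam : 0 < lam)
    {u v : TimeSet T} (huv : u ≤ v) (hρ : rho P 𝓕 V u v ≤ ENNReal.ofReal (jnThreshold lam)) :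
    ExpLe lam P 𝓕 V u v (expE (ENNReal.ofReal (2 + 2 * lam))) := by
  intro B hB
  set g : ℝ≥0∞ → ℝ≥0∞ := fun x => expE (ENNReal.ofReal lam * x) with hg
  set e : ℝ≥0∞ := expE (ENNReal.ofReal lam) with he
  have hga : g 1 ≠ 0 := (lt_of_lt_of_le one_pos (one_le_expE _)).ne'
  refine (johnNirenberg h𝓕 hV hA huv one_ne_zero ENNReal.one_ne_top
    (θ := ENNReal.ofReal (jnThreshold lam)) (by rwa [one_mul])
    (monotone_expE_mul lam) hga hB).trans (mul_le_mul_left ?_ _)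
  have heq : e = ENNReal.ofReal (Real.exp lam) := expE_ofReal hlam.le
  -- With a = 1 and θ = exp(-λ)/2 the series is exp(2λ) ∑ 2^{-k}. The total exp(λ) + 2 exp(2λ) is at
  -- most 3 exp(2λ) ≤ exp(2 + 2λ).
  have hk (k : ℕ) : g ((k + 2) * 1) * ENNReal.ofReal (jnThreshold lam) ^ k
      = e ^ 2 * 2⁻¹ ^ k := by
    have h1 : g ((k + 2) * 1) = e ^ (k + 2) := by
      rw [he, ← expE_nat_mul, hg]
      push_cast
      ring_nf
    have h2 : e * ENNReal.ofReal (jnThreshold lam) = 2⁻¹ := by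
      rw [heq, jnThreshold, ← ENNReal.ofReal_mul (Real.exp_pos _).le, mul_div_assoc',
        ← Real.exp_add, add_neg_cancel, Real.exp_zero, one_div, ENNReal.ofReal_inv_of_pos two_pos]
      simp
    rw [h1, pow_add, mul_right_comm, ← mul_pow, h2, mul_comm]
  change g 1 + ∑' k : ℕ, g ((k + 2) * 1) * ENNReal.ofReal (jnThreshold lam) ^ k ≤ _
  simp only [hk]
  rw [ENNReal.tsum_mul_left, ENNReal.tsum_geometric, ENNReal.one_sub_inv_two, inv_inv]
  have h1 : g 1 = e := by simp [hg, he]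
  rw [h1, heq, ← ENNReal.ofReal_pow (Real.exp_pos _).le,
    show (2 : ℝ≥0∞) = ENNReal.ofReal 2 by simp, ← ENNReal.ofReal_mul (by positivity),
    ← ENNReal.ofReal_add (by positivity) (by positivity), expE_ofReal (by positivity)]
  refine ENNReal.ofReal_le_ofReal ?_
  have h2 : Real.exp lam ^ 2 = Real.exp (2 * lam) := by
    rw [← Real.exp_nat_mul]
    norm_num
  have h3 : Real.exp lam ≤ Real.exp (2 * lam) := Real.exp_le_exp.2 (by linarith)
  have h4 : (3 : ℝ) ≤ Real.exp 2 := by linarith [Real.add_one_le_exp 2]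
  rw [Real.exp_add, h2]
  nlinarith [Real.exp_pos (2 * lam)]

lemma exists_seq_right {s t : TimeSet T} (h : s < t) :
    ∃ x : ℕ → TimeSet T, (∀ n, x n ∈ Set.Ioo s t) ∧ Tendsto x atTop (𝓝[>] s) := by
  have hne : (𝓝[>] s).NeBot := nhdsGT_neBot_of_exists_gt ⟨t, h⟩
  obtain ⟨x, hx⟩ := (𝓝[>] s).exists_seq_tendsto
  obtain ⟨N, hN⟩ := eventually_atTop.1 (hx.eventually (Ioo_mem_nhdsGT h))
  exact ⟨fun n => x (n + N), fun n => hN _ (by omega), hx.comp (tendsto_add_atTop_nat N)⟩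

lemma exists_seq_left {s t : TimeSet T} (h : s < t) :
    ∃ x : ℕ → TimeSet T, (∀ n, x n ∈ Set.Ioo s t) ∧ Tendsto x atTop (𝓝[<] t) := by
  have hne : (𝓝[<] t).NeBot := nhdsLT_neBot_of_exists_lt ⟨s, h⟩
  obtain ⟨x, hx⟩ := (𝓝[<] t).exists_seq_tendsto
  obtain ⟨N, hN⟩ := eventually_atTop.1 (hx.eventually (Ioo_mem_nhdsLT h))
  exact ⟨fun n => x (n + N), fun n => hN _ (by omega), hx.comp (tendsto_add_atTop_nat N)⟩

lemma maxIncr_le_liminf {ω : Ω} (hf : IsCadlagPath fun t => V t ω) {s t : TimeSet T} (hst : s < t)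
    {x y : ℕ → TimeSet T} (hx : Tendsto x atTop (𝓝[>] s)) (hy : Tendsto y atTop (𝓝[<] t)) :
    maxIncr V s t ω ≤ ‖jump V t ω‖ₑ + liminf (fun n => maxIncr V (x n) (y n) ω) atTop := by
  have hxs : Tendsto (fun n => V (x n) ω) atTop (𝓝 (V s ω)) := (hf s).1.tendsto.comp hx
  refine iSup₂_le fun z hz => ?_
  rcases hz.2.eq_or_lt with rfl | hzt
  · have hyl := (tendsto_leftLimit hf hst).comp hy
    obtain ⟨m, hm⟩ := exists_between hst
    have hlim := (hyl.sub hxs).enorm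
    calc ‖V z ω - V s ω‖ₑ = ‖jump V z ω + (leftLimit V z ω - V s ω)‖ₑ := by
          congr 1
          simp only [jump]
          abel
      _ ≤ ‖jump V z ω‖ₑ + ‖leftLimit V z ω - V s ω‖ₑ := enorm_add_le _ _
      _ ≤ _ := by
          gcongr
          rw [← hlim.liminf_eq]
          refine liminf_le_liminf ?_
          filter_upwards [hx.eventually (Ioo_mem_nhdsGT hm.1),
            hy.eventually (Ioo_mem_nhdsLT hm.2)] with n h1 h2
          exact le_maxIncr ⟨(h1.2.trans h2.1).le, le_rfl⟩ ω
  rcases hz.1.eq_or_lt with rfl | hsz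
  · simp
  have hlim := (hxs.const_sub (V z ω)).enorm
  refine le_trans ?_ le_add_self
  rw [← hlim.liminf_eq]
  refine liminf_le_liminf ?_
  filter_upwards [hx.eventually (Ioo_mem_nhdsGT hsz),
    hy.eventually (Ioo_mem_nhdsLT hzt)] with n h1 h2
  exact le_maxIncr ⟨h1.2.le, h2.1.le⟩ ω

/-- Smallness of ρ is assumed only strictly inside (s,t), which is all an inner control sees. Inner
intervals exhaust (s,t), Fatou passes to the limit, and the jump at t contributes the factor with J.
-/
lemma expLe_interval [IsProbabilityMeasure P] (h𝓕 : 𝓕.IsRightContinuous)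
    (hV : ∀ ω, IsCadlagPath fun t => V t ω) (hA : StronglyAdapted 𝓕 V) {lam : ℝ} (hlam : 0 < lam)
    {s t : TimeSet T} (hst : s < t)
    (hρ : ∀ u v, s < u → u < v → v < t → rho P 𝓕 V u v ≤ ENNReal.ofReal (jnThreshold lam))
    {J : ℝ≥0∞} (hJ : ∀ᵐ ω ∂P, ‖jump V t ω‖ₑ ≤ J) :
    ExpLe lam P 𝓕 V s t (expE (ENNReal.ofReal (2 + 2 * lam) + ENNReal.ofReal lam * J)) := by
  intro B hB
  obtain ⟨m, hm⟩ := exists_between hst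
  obtain ⟨x, hx, hxl⟩ := exists_seq_right hm.1
  obtain ⟨y, hy, hyl⟩ := exists_seq_left hm.2
  set φ : ℝ≥0∞ → ℝ≥0∞ := fun x => expE (ENNReal.ofReal lam * x) with hφ
  have hxy (n : ℕ) : x n < y n := (hx n).2.trans (hy n).1
  have hmeas (n : ℕ) : Measurable fun ω => φ (maxIncr V (x n) (y n) ω) :=
    (continuous_expE_mul lam).measurable.comp
      ((measurable_maxIncr hV hA (hxy n).le).mono (𝓕.le _) le_rfl)
  calc ∫⁻ ω in B, φ (maxIncr V s t ω) ∂P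
      ≤ ∫⁻ ω in B, φ J * liminf (fun n => φ (maxIncr V (x n) (y n) ω)) atTop ∂P := by
        refine lintegral_mono_ae (ae_restrict_of_ae ?_)
        filter_upwards [hJ] with ω hω
        have h1 := maxIncr_le_liminf (hV ω) hst hxl hyl
        have h2 : φ (liminf (fun n => maxIncr V (x n) (y n) ω) atTop) =
            liminf (fun n => φ (maxIncr V (x n) (y n) ω)) atTop :=
          (monotone_expE_mul lam).map_liminf_of_continuousAt _
            (continuous_expE_mul lam).continuousAt
        rw [← h2, hφ]
        simp only
        rw [← expE_add, ← mul_add]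
        exact monotone_expE_mul lam (h1.trans (add_le_add_left hω _))
    _ = φ J * ∫⁻ ω in B, liminf (fun n => φ (maxIncr V (x n) (y n) ω)) atTop ∂P :=
        lintegral_const_mul _ (Measurable.liminf hmeas)
    _ ≤ φ J * liminf (fun n => ∫⁻ ω in B, φ (maxIncr V (x n) (y n) ω) ∂P) atTop := by
        gcongr
        exact lintegral_liminf_le hmeas
    _ ≤ φ J * (expE (ENNReal.ofReal (2 + 2 * lam)) * P B) := by
        gcongr
        refine liminf_le_of_frequently_le' (Eventually.frequently (Eventually.of_forall fun n => ?_))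
        exact expLe_of_rho h𝓕 hV hA hlam (hxy n).le (hρ _ _ (hx n).1 (hxy n) (hy n).2) B
          (𝓕.mono (hx n).1.le _ hB)
    _ = _ := by
        rw [expE_add]
        ring

section Chain

variable [IsProbabilityMeasure P] (h𝓕 : 𝓕.IsRightContinuous)
  (hV : ∀ ω, IsCadlagPath fun t => V t ω) (hA : StronglyAdapted 𝓕 V) {lam : ℝ} (hlam : 0 < lam)
  {w : TimeSet T → TimeSet T → ℝ≥0∞} (hw : IsRegularControl w) {β : ℝ≥0∞}
  (hρ : ∀ s t, s < t → w s t ≤ β → ∀ u v, s < u → u < v → v < t →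
    rho P 𝓕 V u v ≤ ENNReal.ofReal (jnThreshold lam))
  {r : TimeSet T} {J : ℝ≥0∞} (hJ : ∀ t, r < t → ∀ᵐ ω ∂P, ‖jump V t ω‖ₑ ≤ J)

include h𝓕 hV hA hlam hw hρ hJ

/-- A greedy step at level β peels off one piece on which `expLe_interval` applies, and the
remainder has lost β of its control. -/
lemma expLe_of_control_le (n : ℕ) {s t : TimeSet T} (hrs : r ≤ s) (hst : s ≤ t)
    (hwst : w s t ≤ (n + 1) * β) : ExpLe lam P 𝓕 V s t
      (expE (ENNReal.ofReal (2 + 2 * lam) + ENNReal.ofReal lam * J) ^ (n + 1)) := by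
  induction n generalizing s with
  | zero =>
    rcases hst.eq_or_lt with rfl | hst
    · exact (expLe_self lam P 𝓕 V s).mono (one_le_pow₀ (one_le_expE _))
    · rw [zero_add, pow_one]
      exact expLe_interval h𝓕 hV hA hlam hst (hρ s t hst (by simpa using hwst))
        (hJ t (hrs.trans_lt hst))
  | succ n ih =>
    set m := nextTime w β t s with hm
    have hsm : s ≤ m := le_nextTime hst
    have hmt : m ≤ t := nextTime_le
    have h1 : ExpLe lam P 𝓕 V s m
        (expE (ENNReal.ofReal (2 + 2 * lam) + ENNReal.ofReal lam * J)) := by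
      rcases hsm.eq_or_lt with h | h
      · rw [← h]
        exact (expLe_self lam P 𝓕 V s).mono (one_le_expE _)
      · exact expLe_interval h𝓕 hV hA hlam h (hρ s m h (hw.nextTime_le_threshold h))
          (hJ m (hrs.trans_lt h))
    rcases hmt.eq_or_lt with h | h
    · rw [← h]
      exact h1.mono (le_self_pow₀ (one_le_expE _) (by omega))
    · rw [pow_succ']
      refine h1.trans hV hA hsm hmt (ih (hrs.trans hsm) hmt ?_)
      have h2 := (hw.threshold_add_le h).trans hwst
      by_cases hβ : β = ∞
      · simp [hβ]
      · push_cast at h2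
        rw [add_mul _ 1 β, one_mul, add_comm β] at h2
        exact (ENNReal.add_le_add_iff_right hβ).1 h2

lemma expLe_greedyTime {α : ℝ≥0∞} (n : ℕ) (hα : α ≤ (n + 1) * β) {t : TimeSet T} (hrt : r ≤ t)
    (i : ℕ) : ExpLe lam P 𝓕 V r (greedyTime w α r t i)
      (expE (ENNReal.ofReal (2 + 2 * lam) + ENNReal.ofReal lam * J) ^ ((n + 1) * i)) := by
  induction i with
  | zero => exact (expLe_self lam P 𝓕 V r).mono (by simp)
  | succ i ih =>
    have h1 := greedyTime_le (w := w) (α := α) hrt i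
    have h2 := le_greedyTime (w := w) (α := α) hrt i
    have h3 : greedyTime w α r t i ≤ greedyTime w α r t (i + 1) := le_nextTime h1
    rw [mul_add, mul_one, pow_add]
    refine ih.trans hV hA h2 h3 ?_
    rcases h3.eq_or_lt with h | h
    · rw [← h]
      exact (expLe_self lam P 𝓕 V _).mono (one_le_pow₀ (one_le_expE _))
    · exact expLe_of_control_le h𝓕 hV hA hlam hw hρ hJ n h2 h.le
        ((hw.nextTime_le_threshold h).trans hα)

lemma expBound_of_control (hT : 0 < T) {α : ℝ} (hα0 : 0 < α) (n : ℕ)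
    (hα : ENNReal.ofReal α ≤ (n + 1) * β) (hsup : supJump P V r ≠ ∞) (hJs : J = supJump P V r) :
    ExpBound hT ((n + 1) * (2 + 3 * lam)) α lam w P 𝓕 V r := by
  have hrt : r ≤ finish hT := Subtype.coe_le_coe.1 r.2.2
  have hN := hw.countN_ne_top hrt (ENNReal.ofReal_pos.2 hα0).ne'
  refine ⟨hN, hsup, ?_⟩
  obtain ⟨N, hN⟩ := ENat.ne_top_iff_exists.1 hN
  have hmain := expLe_greedyTime h𝓕 hV hA hlam hw hρ hJ n hα hrt (N + 1)
  rw [greedyTime_countN hrt hN.symm] at hmain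
  have hIci : Set.Ici r = Set.Icc r (finish hT) := by
    ext x
    simp only [mem_Ici, mem_Icc, iff_self_and]
    exact fun _ => Subtype.coe_le_coe.1 x.2.2
  rw [expMoment, hIci]
  refine ((essSup_condLExp_le_iff (𝓕.le r)).2 hmain).trans ?_
  -- There are (n+1)(N+1) pieces, each with exponent 2 + 2λ + λJ ≤ (2 + 3λ)(1 + J).
  rw [← expE_nat_mul, ← hN, ← hJs]
  refine expE_mono ?_
  push_cast
  have h1 : ENNReal.ofReal (2 + 2 * lam) + ENNReal.ofReal lam * J ≤
      ENNReal.ofReal (2 + 3 * lam) * (1 + J) := by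
    rw [mul_add, mul_one]
    gcongr <;> linarith
  rw [ENNReal.ofReal_mul (by positivity), show ENNReal.ofReal ((n : ℝ) + 1) = n + 1 by
    rw [ENNReal.ofReal_add (by positivity) (by positivity)]; simp]
  calc _ ≤ ((n : ℝ≥0∞) + 1) * (N + 1) * (ENNReal.ofReal (2 + 3 * lam) * (1 + J)) := by gcongr
    _ = _ := by ring

end Chain

/-! ### Comparison of conditional norms -/

lemma le_mul_of_forall_gt {x d K : ℝ≥0∞} (hK0 : K ≠ 0) (hK : K ≠ ∞)
    (h : ∀ c, d < c → c ≠ ∞ → x ≤ K * c) : x ≤ K * d := by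
  rw [← ENNReal.div_le_iff' hK0 hK]
  refine le_of_forall_gt_imp_ge_of_dense fun c hc => ?_
  by_cases hct : c = ∞
  · simp [hct]
  · rw [ENNReal.div_le_iff' hK0 hK]
    exact h c hc hct

lemma le_add_mul_rpow {q : ℝ} (hq : 1 ≤ q) (x : ℝ≥0∞) {c : ℝ≥0∞} (hc0 : c ≠ 0) (hc : c ≠ ∞) :
    x ≤ c + c * (x ^ q * c⁻¹ ^ q) := by
  rcases le_total x c with h | h
  · exact h.trans le_self_add
  · refine le_trans ?_ le_add_self
    rw [← ENNReal.mul_rpow_of_nonneg _ _ (by linarith)]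
    have h1 : 1 ≤ x * c⁻¹ := by
      rw [← div_eq_mul_inv, ENNReal.le_div_iff_mul_le (Or.inl hc0) (Or.inl hc), one_mul]
      exact h
    calc x = c * (x * c⁻¹) := by
          rw [mul_comm x, ← mul_assoc, ENNReal.mul_inv_cancel hc0 hc, one_mul]
      _ ≤ c * (x * c⁻¹) ^ q := by
          gcongr
          exact ENNReal.le_rpow_self_of_one_le h1 hq

/-- The elementary bound x ≤ c + c (x/c)^q stands in for Jensen. The factor 2 is harmless, since
only finiteness of the variation is drawn from it. -/
lemma condNorm_one_le [IsProbabilityMeasure P] (hA : StronglyAdapted 𝓕 V) {q : ℝ} (hq : 1 ≤ q)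
    (s t : TimeSet T) : condNorm 1 P 𝓕 V s t ≤ 2 * condNorm q P 𝓕 V s t := by
  refine le_mul_of_forall_gt two_ne_zero ENNReal.ofNat_ne_top fun c hc hct => ?_
  have hc0 : c ≠ 0 := (zero_le.trans_lt hc).ne'
  rw [condNorm_le_iff le_rfl]
  intro A hAs
  simp only [ENNReal.rpow_one]
  have hm : Measurable fun ω => ‖V t ω - V s ω‖ₑ :=
    (hA.stronglyMeasurable.sub hA.stronglyMeasurable).enorm
  have hinv : c ^ q * c⁻¹ ^ q = 1 := by
    rw [← ENNReal.mul_rpow_of_nonneg _ _ (by linarith), ENNReal.mul_inv_cancel hc0 hct,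
      ENNReal.one_rpow]
  calc ∫⁻ ω in A, ‖V t ω - V s ω‖ₑ ∂P
      ≤ ∫⁻ ω in A, (c + c * (‖V t ω - V s ω‖ₑ ^ q * c⁻¹ ^ q)) ∂P :=
        lintegral_mono fun ω => le_add_mul_rpow hq _ hc0 hct
    _ = c * P A + c * ((∫⁻ ω in A, ‖V t ω - V s ω‖ₑ ^ q ∂P) * c⁻¹ ^ q) := by
        rw [lintegral_add_left measurable_const, setLIntegral_const,
          lintegral_const_mul _ ((hm.pow_const q).mul_const _),
          lintegral_mul_const _ (hm.pow_const q)]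
    _ ≤ c * P A + c * ((c ^ q * P A) * c⁻¹ ^ q) := by
        gcongr
        exact (condNorm_le_iff hq).1 hc.le A hAs
    _ = c * P A + c * P A * (c ^ q * c⁻¹ ^ q) := by ring
    _ = 2 * c * P A := by rw [hinv]; ring

/-- The `q`-th moment bound `1 + ∑ (k + 2)^q 2^{-k}` of the John–Nirenberg tails. -/
def momentSum (q : ℝ) : ℝ≥0∞ := 1 + ∑' k : ℕ, ((k : ℝ≥0∞) + 2) ^ q * 2⁻¹ ^ k

lemma momentSum_ne_top (q : ℝ) : momentSum q ≠ ∞ := by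
  refine ENNReal.add_ne_top.2 ⟨ENNReal.one_ne_top, ?_⟩
  set m := ⌈q⌉₊
  have hs : Summable fun k : ℕ => ((k : ℝ) + 2) ^ m * (1 / 2 : ℝ) ^ k := by
    have h1 := (summable_pow_mul_geometric_of_norm_lt_one (R := ℝ) m
      (r := 1 / 2) (by norm_num)).comp_injective (add_left_injective 2)
    refine (h1.mul_left 4).congr fun k => ?_
    simp only [Function.comp_apply, pow_add]
    push_cast
    ring
  refine ne_top_of_le_ne_top hs.tsum_ofReal_ne_top (ENNReal.tsum_le_tsum fun k => ?_)
  rw [ENNReal.ofReal_mul (by positivity), ENNReal.ofReal_pow (by positivity),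
    ENNReal.ofReal_pow (by positivity), one_div, ENNReal.ofReal_inv_of_pos two_pos,
    ENNReal.ofReal_add (by positivity) (by positivity)]
  simp only [ENNReal.ofReal_natCast, ENNReal.ofReal_ofNat]
  gcongr
  rw [← ENNReal.rpow_natCast]
  refine ENNReal.rpow_le_rpow_of_exponent_le ?_ (Nat.le_ceil q)
  calc (1 : ℝ≥0∞) ≤ 2 := by norm_num
    _ ≤ k + 2 := le_add_self

lemma condNorm_le_rho [IsProbabilityMeasure P] (h𝓕 : 𝓕.IsRightContinuous)
    (hV : ∀ ω, IsCadlagPath fun t => V t ω) (hA : StronglyAdapted 𝓕 V) {q : ℝ} (hq : 1 ≤ q)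
    {s t : TimeSet T} (hst : s ≤ t) :
    condNorm q P 𝓕 V s t ≤ 2 * momentSum q ^ (1 / q) * rho P 𝓕 V s t := by
  have hq0 : 0 < q := by linarith
  have hM1 : 1 ≤ momentSum q := le_self_add
  refine le_mul_of_forall_gt ?_ ?_ fun c hc hct => ?_
  · exact mul_ne_zero two_ne_zero (ENNReal.rpow_pos (one_pos.trans_le hM1) (momentSum_ne_top q)).ne'
  · exact ENNReal.mul_ne_top ENNReal.ofNat_ne_top
      (ENNReal.rpow_ne_top_of_nonneg (by positivity) (momentSum_ne_top q))
  have hc0 : c ≠ 0 := (zero_le.trans_lt hc).ne'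
  rw [condNorm_le_iff hq]
  intro B hB
  have ha0 : 2 * c ≠ 0 := mul_ne_zero two_ne_zero hc0
  have hat : 2 * c ≠ ∞ := ENNReal.mul_ne_top ENNReal.ofNat_ne_top hct
  -- Level spacing 2c gives ratio θ = 1/2, hence the series in `momentSum`.
  have hκ : rho P 𝓕 V s t ≤ 2 * c * 2⁻¹ := by
    rw [mul_comm 2 c, mul_assoc, ENNReal.mul_inv_cancel two_ne_zero ENNReal.ofNat_ne_top, mul_one]
    exact hc.le
  have hjn := johnNirenberg h𝓕 hV hA hst ha0 hat hκ (g := fun x => x ^ q)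
    (ENNReal.monotone_rpow_of_nonneg hq0.le)
    (ENNReal.rpow_pos (pos_iff_ne_zero.2 ha0) hat).ne' hB
  have heq : (2 * momentSum q ^ (1 / q) * c) ^ q =
      (2 * c) ^ q + ∑' k : ℕ, (((k : ℝ≥0∞) + 2) * (2 * c)) ^ q * 2⁻¹ ^ k := by
    rw [mul_right_comm, ENNReal.mul_rpow_of_nonneg _ _ hq0.le, ← ENNReal.rpow_mul,
      one_div, inv_mul_cancel₀ hq0.ne', ENNReal.rpow_one, momentSum, mul_add, mul_one,
      ← ENNReal.tsum_mul_left]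
    congr 1
    refine tsum_congr fun k => ?_
    rw [ENNReal.mul_rpow_of_nonneg _ (2 * c) hq0.le]
    ring
  rw [heq]
  refine le_trans (lintegral_mono fun ω => ?_) hjn
  exact ENNReal.rpow_le_rpow (le_maxIncr ⟨hst, le_rfl⟩ ω) hq0.le

/-! ### Invariance under indistinguishability -/

section Congr

variable {V' : TimeSet T → Ω → E} (h : ∀ᵐ ω ∂P, ∀ t, V t ω = V' t ω)

include h

lemma ae_leftLimit_congr : ∀ᵐ ω ∂P, ∀ t, V t ω = V' t ω ∧ leftLimit V t ω = leftLimit V' t ω := by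
  filter_upwards [h] with ω hω t
  refine ⟨hω t, ?_⟩
  rw [leftLimit, leftLimit, funext hω]

lemma rho_congr (𝓕 : Filtration (TimeSet T) mΩ) : rho P 𝓕 V = rho P 𝓕 V' := by
  funext s t
  simp only [rho]
  refine iSup_congr fun σ => iSup_congr fun τ => iSup_congr fun hσ => iSup_congr fun _ =>
    iSup_congr fun _ => essSup_congr_ae (condLExp_congr_ae ?_)
  filter_upwards [ae_leftLimit_congr h] with ω hω
  rw [(hω _).1, (hω _).2]

lemma condNorm_congr (q : ℝ) (𝓕 : Filtration (TimeSet T) mΩ) :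
    condNorm q P 𝓕 V = condNorm q P 𝓕 V' := by
  funext s t
  rw [condNorm, condNorm]
  congr 1
  refine essSup_congr_ae (condLExp_congr_ae ?_)
  filter_upwards [h] with ω hω
  rw [hω, hω]

lemma GamNorm_congr : GamNorm P V = GamNorm P V' := by
  funext s t
  refine essSup_congr_ae ?_
  filter_upwards [ae_leftLimit_congr h] with ω hω
  simp only [Gam, jump, (hω _).1, (hω _).2]

lemma supJump_congr : supJump P V = supJump P V' := by
  funext r
  refine iSup_congr fun t => iSup_congr fun _ => eLpNorm_congr_ae ?_
  filter_upwards [ae_leftLimit_congr h] with ω hω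
  simp only [jump, (hω _).1, (hω _).2]

lemma expMoment_congr (lam : ℝ) (𝓕 : Filtration (TimeSet T) mΩ) :
    expMoment lam P 𝓕 V = expMoment lam P 𝓕 V' := by
  funext r
  refine essSup_congr_ae (condLExp_congr_ae ?_)
  filter_upwards [h] with ω hω
  simp only [hω]

lemma bmoControl_congr (p : ℝ) (𝓕 : Filtration (TimeSet T) mΩ) :
    bmoControl p P 𝓕 V = bmoControl p P 𝓕 V' := by
  unfold bmoControl
  rw [rho_congr h]

lemma jumpControl_congr (p : ℝ) (𝓕 : Filtration (TimeSet T) mΩ) :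
    jumpControl p P 𝓕 V = jumpControl p P 𝓕 V' := by
  unfold jumpControl
  rw [condNorm_congr h, GamNorm_congr h]

lemma expBound_congr (hT : 0 < T) (C α lam : ℝ) (w : TimeSet T → TimeSet T → ℝ≥0∞)
    (𝓕 : Filtration (TimeSet T) mΩ) :
    ExpBound hT C α lam w P 𝓕 V = ExpBound hT C α lam w P 𝓕 V' := by
  unfold ExpBound
  rw [supJump_congr h, expMoment_congr h]

end Congr

/-- Paths that are not càdlàg are set to zero. Completeness puts this null set into every 𝓕 t, so
adaptedness survives. -/
lemma exists_cadlag_modification (hU : UsualConditions P 𝓕) (hA : StronglyAdapted 𝓕 V)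
    (hc : IsCadlag P V) : ∃ V' : TimeSet T → Ω → E, StronglyAdapted 𝓕 V' ∧
      (∀ ω, IsCadlagPath fun t => V' t ω) ∧ ∀ᵐ ω ∂P, ∀ t, V t ω = V' t ω := by
  set G : Set Ω := {ω | IsCadlagPath fun t => V t ω}
  have hG : P Gᶜ = 0 := hc
  refine ⟨fun t => G.indicator (V t), fun t => ?_, fun ω => ?_, ?_⟩
  · refine (hA t).indicator ?_
    have := (hU.complete Gᶜ hG t).compl
    rwa [compl_compl] at this
  · by_cases hω : ω ∈ G
    · simp only [indicator_of_mem hω]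
      exact hω
    · simp only [indicator_of_notMem hω]
      exact fun t => ⟨continuousWithinAt_const, 0, tendsto_const_nhds⟩
  · filter_upwards [hc] with ω hω t
    rw [indicator_of_mem (show ω ∈ G from hω)]

/-! ### The two controls -/

lemma ae_enorm_jump_le_supJump {r t : TimeSet T} (h : r < t) :
    ∀ᵐ ω ∂P, ‖jump V t ω‖ₑ ≤ supJump P V r := by
  have h1 : eLpNorm (jump V t) ∞ P ≤ supJump P V r :=
    le_iSup₂ (α := ℝ≥0∞) (f := fun t (_ : t ∈ Set.Ioi r) => eLpNorm (jump V t) ∞ P) t h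
  rw [eLpNorm_exponent_top] at h1
  filter_upwards [ae_le_eLpNormEssSup (f := jump V t) (μ := P)] with ω hω
  exact hω.trans h1

lemma supJump_le_GamNorm (hT : 0 < T) (r : TimeSet T) :
    supJump P V r ≤ GamNorm P V (start hT) (finish hT) := by
  refine iSup₂_le fun t _ => ?_
  rw [eLpNorm_exponent_top]
  refine essSup_le_of_ae_le _ ?_
  filter_upwards [ae_enorm_jump_le_GamNorm (P := P) (V := V) (s := start hT) (t := finish hT)]
    with ω hω
  exact hω t ⟨Subtype.coe_le_coe.1 t.2.1, Subtype.coe_le_coe.1 t.2.2⟩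

section Control

variable [IsProbabilityMeasure P]

lemma start_lt_finish (hT : 0 < T) : start hT < finish hT := hT

lemma pSum_ne_top (hT : 0 < T) {p : ℝ} (hp : 1 ≤ p) {F : TimeSet T → TimeSet T → ℝ≥0∞}
    (hF : pVar p F (start hT) (finish hT) < ∞) (s t : TimeSet T) (hst : s ≤ t) :
    pSum p F s t ≠ ∞ :=
  (((superadd_pSum p F).mono (Subtype.coe_le_coe.1 s.2.1) hst
    (Subtype.coe_le_coe.1 t.2.2)).trans_lt ((pVar_lt_top_iff hp _ _).1 hF)).ne

lemma pVar_lt_top_of_le (hT : 0 < T) {p : ℝ} (hp : 1 ≤ p)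
    {F G : TimeSet T → TimeSet T → ℝ≥0∞} {K : ℝ≥0∞} (hK : K ≠ ∞)
    (hG : pVar p G (start hT) (finish hT) < ∞) (h : ∀ s t, s < t → F s t ≤ K * G s t) :
    pVar p F (start hT) (finish hT) < ∞ := by
  have hp0 : 0 ≤ p := by linarith
  rw [pVar_lt_top_iff hp] at hG ⊢
  refine (pSum_le_of_superadd (W := fun s t => K ^ p * pSum p G s t)
    ((superadd_pSum p G).const_mul _) (fun s t hst => ?_) _ _).trans_lt
    (ENNReal.mul_lt_top (ENNReal.rpow_lt_top_of_nonneg hp0 hK) hG)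
  calc F s t ^ p ≤ (K * G s t) ^ p := ENNReal.rpow_le_rpow (h s t hst) hp0
    _ = K ^ p * G s t ^ p := ENNReal.mul_rpow_of_nonneg _ _ hp0
    _ ≤ _ := by
      gcongr
      exact rpow_le_pSum p G hst

lemma le_of_inner_le {p : ℝ} (hp : 1 ≤ p) {F : TimeSet T → TimeSet T → ℝ≥0∞} {c : ℝ≥0∞}
    {s u v t : TimeSet T} (h : inner (pSum p F) s t ≤ c ^ p) (h1 : s < u) (h2 : u < v)
    (h3 : v < t) : F u v ≤ c := by
  have := ((rpow_le_pSum p F h2).trans (le_inner h1 h2.le h3)).trans h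
  rwa [ENNReal.rpow_le_rpow_iff (by linarith)] at this

lemma jnThreshold_pos (lam : ℝ) : 0 < jnThreshold lam := by
  rw [jnThreshold]
  positivity

/-- The threshold for the controls which guarantees exponential moments of order `lam`. -/
def controlThreshold (p lam : ℝ) : ℝ≥0∞ := ENNReal.ofReal (jnThreshold lam / 3) ^ p

/-- The number of pieces into which a greedy interval is cut. -/
def pieces (p α lam : ℝ) : ℕ := ⌈α / (jnThreshold lam / 3) ^ p⌉₊

lemma le_pieces_mul (p α lam : ℝ) :
    ENNReal.ofReal α ≤ ((pieces p α lam : ℝ≥0∞) + 1) * controlThreshold p lam := by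
  have h0 := jnThreshold_pos lam
  have h1 : α / (jnThreshold lam / 3) ^ p ≤ pieces p α lam := Nat.le_ceil _
  rw [div_le_iff₀ (by positivity)] at h1
  rw [controlThreshold, ENNReal.ofReal_rpow_of_pos (by positivity)]
  refine (ENNReal.ofReal_le_ofReal h1).trans ?_
  rw [ENNReal.ofReal_mul (by positivity), ENNReal.ofReal_natCast]
  gcongr
  exact le_self_add

lemma bmoControl_bound (h𝓕 : 𝓕.IsRightContinuous)
    (hV : ∀ ω, IsCadlagPath fun t => V t ω) (hA : StronglyAdapted 𝓕 V) (hT : 0 < T)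
    {p α lam : ℝ} (hp : 1 ≤ p) (hα : 0 < α) (hlam : 0 < lam)
    (hfin : pVar p (rho P 𝓕 V) (start hT) (finish hT) < ∞) :
    IsRegularControl (bmoControl p P 𝓕 V) ∧
      ∀ r, ExpBound hT ((pieces p α lam + 1) * (2 + 3 * lam)) α lam (bmoControl p P 𝓕 V) P 𝓕 V r := by
  have heq : bmoControl p P 𝓕 V = inner (pSum p (rho P 𝓕 V)) := by
    funext s t
    exact pVarIoo_rpow hp _ s t
  have hreg : IsRegularControl (bmoControl p P 𝓕 V) := by
    rw [heq]
    exact isRegularControl_inner (superadd_pSum p _) (pSum_ne_top hT hp hfin)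
  refine ⟨hreg, fun r => ?_⟩
  have h0 := jnThreshold_pos lam
  refine expBound_of_control h𝓕 hV hA hlam hreg (β := controlThreshold p lam) ?_
    (fun t ht => ae_enorm_jump_le_supJump ht) hT hα _ (le_pieces_mul p α lam) ?_ rfl
  · intro s t _ hw u v h1 h2 h3
    rw [heq] at hw
    -- The factor 1/3 in the threshold is slack here; it is kept so that both controls share one
    -- constant.
    exact (le_of_inner_le hp hw h1 h2 h3).trans (ENNReal.ofReal_le_ofReal (by linarith))
  · refine ne_top_of_le_ne_top hfin.ne ((supJump_le_GamNorm hT r).trans ?_)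
    exact (GamNorm_le_rho h𝓕 hV hA (start_lt_finish hT).le).trans (le_pVar hp (start_lt_finish hT))

lemma condNorm_self {q : ℝ} (hq : 1 ≤ q) (s : TimeSet T) : condNorm q P 𝓕 V s s = 0 := by
  rw [← nonpos_iff_eq_zero, condNorm_le_iff hq]
  intro A _
  have : (0 : ℝ≥0∞) ^ q = 0 := ENNReal.zero_rpow_of_pos (by linarith)
  simp [this]

lemma jumpControl_bound (h𝓕 : 𝓕.IsRightContinuous)
    (hV : ∀ ω, IsCadlagPath fun t => V t ω) (hA : StronglyAdapted 𝓕 V) (hT : 0 < T)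
    {p q α lam : ℝ} (hp : 1 ≤ p) (hq : 1 ≤ q) (hα : 0 < α) (hlam : 0 < lam)
    (hfin : pVar p (condNorm q P 𝓕 V) (start hT) (finish hT) < ∞)
    (hΓ : pVar p (GamNorm P V) (start hT) (finish hT) < ∞) :
    IsRegularControl (jumpControl p P 𝓕 V) ∧
      ∀ r, ExpBound hT ((pieces p α lam + 1) * (2 + 3 * lam)) α lam
        (jumpControl p P 𝓕 V) P 𝓕 V r := by
  have hfin1 : pVar p (condNorm 1 P 𝓕 V) (start hT) (finish hT) < ∞ :=
    pVar_lt_top_of_le hT hp ENNReal.ofNat_ne_top hfin fun s t _ => condNorm_one_le hA hq s t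
  have heq' : ∀ s t, jumpControl p P 𝓕 V s t = inner (pSum p (condNorm 1 P 𝓕 V)) s t +
      inner (pSum p (GamNorm P V)) s t := fun s t => by
    rw [jumpControl, pVarIco_rpow hp (condNorm_le_iSup hV hA), pVarIoo_rpow hp]
  have heq : jumpControl p P 𝓕 V =
      inner (fun s t => pSum p (condNorm 1 P 𝓕 V) s t + pSum p (GamNorm P V) s t) := by
    funext s t
    rw [heq', inner_add (superadd_pSum p _) (superadd_pSum p _)]
  have hreg : IsRegularControl (jumpControl p P 𝓕 V) := by
    rw [heq]
    exact isRegularControl_inner ((superadd_pSum p _).add (superadd_pSum p _)) fun s t hst =>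
      ENNReal.add_ne_top.2 ⟨pSum_ne_top hT hp hfin1 s t hst, pSum_ne_top hT hp hΓ s t hst⟩
  refine ⟨hreg, fun r => ?_⟩
  have h0 := jnThreshold_pos lam
  refine expBound_of_control h𝓕 hV hA hlam hreg (β := controlThreshold p lam) ?_
    (fun t ht => ae_enorm_jump_le_supJump ht) hT hα _ (le_pieces_mul p α lam) ?_ rfl
  · intro s t _ hw u v h1 h2 h3
    rw [heq'] at hw
    have hΓuv := le_of_inner_le hp (le_add_self.trans hw) h1 h2 h3
    have hc : ∀ x ∈ Set.Icc u v, condNorm 1 P 𝓕 V x v ≤ ENNReal.ofReal (jnThreshold lam / 3) := by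
      intro x hx
      rcases hx.2.eq_or_lt with rfl | hxv
      · rw [condNorm_self le_rfl]
        exact zero_le
      · exact le_of_inner_le hp (le_self_add.trans hw) (h1.trans_le hx.1) hxv h3
    -- Two conditional means and one jump, each at most a third of the threshold.
    calc rho P 𝓕 V u v ≤ 2 * ENNReal.ofReal (jnThreshold lam / 3) + GamNorm P V u v :=
          rho_le_of_condNorm hV hA hc
      _ ≤ 2 * ENNReal.ofReal (jnThreshold lam / 3) + ENNReal.ofReal (jnThreshold lam / 3) := by
          gcongr
      _ = ENNReal.ofReal (jnThreshold lam) := by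
          rw [show (2 : ℝ≥0∞) = ENNReal.ofReal 2 by simp, ← ENNReal.ofReal_mul two_pos.le,
            ← ENNReal.ofReal_add (by positivity) (by positivity)]
          congr 1
          ring
  · exact ne_top_of_le_ne_top hΓ.ne
      ((supJump_le_GamNorm hT r).trans (le_pVar hp (start_lt_finish hT)))

lemma pVar_rho_lt_top_iff (h𝓕 : 𝓕.IsRightContinuous)
    (hV : ∀ ω, IsCadlagPath fun t => V t ω) (hA : StronglyAdapted 𝓕 V) (hT : 0 < T)
    {p q : ℝ} (hp : 1 ≤ p) (hq : 1 ≤ q) :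
    pVar p (rho P 𝓕 V) (start hT) (finish hT) < ∞ ↔
      pVar p (condNorm q P 𝓕 V) (start hT) (finish hT) < ∞ ∧
        pVar p (GamNorm P V) (start hT) (finish hT) < ∞ := by
  have hp0 : 0 ≤ p := by linarith
  constructor
  · intro h
    refine ⟨pVar_lt_top_of_le hT hp ?_ h fun s t hst => condNorm_le_rho h𝓕 hV hA hq hst.le,
      pVar_lt_top_of_le hT hp ENNReal.one_ne_top h fun s t hst => ?_⟩
    · exact ENNReal.mul_ne_top ENNReal.ofNat_ne_top
        (ENNReal.rpow_ne_top_of_nonneg (by positivity) (momentSum_ne_top q))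
    · rw [one_mul]
      exact GamNorm_le_rho h𝓕 hV hA hst.le
  · rintro ⟨hfin, hΓ⟩
    have hfin1 : pVar p (condNorm 1 P 𝓕 V) (start hT) (finish hT) < ∞ :=
      pVar_lt_top_of_le hT hp ENNReal.ofNat_ne_top hfin fun s t _ => condNorm_one_le hA hq s t
    rw [pVar_lt_top_iff hp] at hfin1 hΓ ⊢
    refine (pSum_le_of_superadd (W := fun s t => 3 ^ p *
      (pSum p (condNorm 1 P 𝓕 V) s t + pSum p (GamNorm P V) s t))
      (((superadd_pSum p _).add (superadd_pSum p _)).const_mul _) (fun s t hst => ?_) _ _).trans_lt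
      (ENNReal.mul_lt_top (ENNReal.rpow_lt_top_of_nonneg hp0 ENNReal.ofNat_ne_top)
        (ENNReal.add_lt_top.2 ⟨hfin1, hΓ⟩))
    set a := pVar p (condNorm 1 P 𝓕 V) s t
    set b := pVar p (GamNorm P V) s t
    -- The variations a and b over [s,t] dominate the increments over every [x,t], and (3
    -- max(a,b))^p ≤ 3^p (a^p + b^p) is a superadditive majorant.
    have hab : rho P 𝓕 V s t ≤ 3 * max a b := by
      refine (rho_le_of_condNorm hV hA (c := a) fun x hx => ?_).trans ?_
      · rcases hx.2.eq_or_lt with rfl | hxt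
        · rw [condNorm_self le_rfl]
          exact zero_le
        · exact (le_pVar hp hxt).trans (pVar_mono hp hx.1 hxt.le le_rfl)
      · calc 2 * a + GamNorm P V s t ≤ 2 * max a b + max a b :=
              add_le_add (mul_le_mul_right (le_max_left _ _) _)
                ((le_pVar hp hst).trans (le_max_right _ _))
          _ = 3 * max a b := by ring
    calc rho P 𝓕 V s t ^ p ≤ (3 * max a b) ^ p := ENNReal.rpow_le_rpow hab hp0
      _ = 3 ^ p * max a b ^ p := ENNReal.mul_rpow_of_nonneg _ _ hp0
      _ ≤ _ := by
        gcongr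
        rw [← pVar_rpow hp, ← pVar_rpow hp]
        rcases max_choice a b with h | h <;> rw [h]
        · exact le_self_add
        · exact le_add_self

end Control

end Stochastic

end JohnNirenberg

end

/-! ### The main theorem. -/

open JohnNirenberg in
theorem mainTheorem7 (p α lam : ℝ) (hp : 1 ≤ p) (hα : 0 < α) (hlam : 0 < lam) :
    ∃ C : ℝ, 0 < C ∧
      ∀ (T : ℝ) (hT : 0 < T) (Ω : Type*) (mΩ : MeasurableSpace Ω) (P : Measure Ω)
        [IsProbabilityMeasure P] (𝓕 : Filtration (JohnNirenberg.TimeSet T) mΩ)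
        (_ : JohnNirenberg.UsualConditions P 𝓕)
        (E : Type*) [NormedAddCommGroup E] [NormedSpace ℝ E]
        (V : JohnNirenberg.TimeSet T → Ω → E),
        -- the bound for `BMO^{p-var}` processes
        (JohnNirenberg.IsBMOpVar hT p P 𝓕 V →
          JohnNirenberg.IsRegularControl (JohnNirenberg.bmoControl p P 𝓕 V) ∧
          ∀ r, JohnNirenberg.ExpBound hT C α lam (JohnNirenberg.bmoControl p P 𝓕 V) P 𝓕 V r) ∧
        -- the bound for adapted processes in `V^p L^{q,∞}` with jumps of finite `p`-variation
        (∀ q : ℝ, 1 ≤ q → StronglyAdapted 𝓕 V → JohnNirenberg.MemVpLqInfty hT p q P 𝓕 V →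
          JohnNirenberg.pVar p (JohnNirenberg.GamNorm P V)
            (JohnNirenberg.start hT) (JohnNirenberg.finish hT) < ∞ →
          JohnNirenberg.IsRegularControl (JohnNirenberg.jumpControl p P 𝓕 V) ∧
          ∀ r, JohnNirenberg.ExpBound hT C α lam (JohnNirenberg.jumpControl p P 𝓕 V) P 𝓕 V r) ∧
        -- the two classes agree when the initial value is in `L^q`
        (∀ q : ℝ, 1 ≤ q → StronglyAdapted 𝓕 V → JohnNirenberg.IsCadlag P V →
          MemLp (V (JohnNirenberg.start hT)) (ENNReal.ofReal q) P →
          (JohnNirenberg.IsBMOpVar hT p P 𝓕 V ↔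
            JohnNirenberg.MemVpLqInfty hT p q P 𝓕 V ∧
            JohnNirenberg.pVar p (JohnNirenberg.GamNorm P V)
              (JohnNirenberg.start hT) (JohnNirenberg.finish hT) < ∞)) := by
  refine ⟨(pieces p α lam + 1) * (2 + 3 * lam), by positivity, ?_⟩
  intro T hT Ω mΩ P _ 𝓕 hU E _ _ V
  refine ⟨fun h => ?_, fun q hq hA h hΓ => ?_, fun q hq hA hc hL => ?_⟩
  -- Variations, controls and moments are unchanged under indistinguishability, so all paths may be
  -- assumed càdlàg.
  · obtain ⟨V', hA', hV', hae⟩ := exists_cadlag_modification hU h.adapted h.cadlag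
    have hfin := h.finite
    rw [rho_congr hae 𝓕] at hfin
    rw [bmoControl_congr hae, expBound_congr hae]
    exact bmoControl_bound hU.rightContinuous hV' hA' hT hp hα hlam hfin
  · obtain ⟨V', hA', hV', hae⟩ := exists_cadlag_modification hU hA h.cadlag
    have hfin := h.finite
    rw [condNorm_congr hae _ 𝓕] at hfin
    rw [GamNorm_congr hae] at hΓ
    rw [jumpControl_congr hae, expBound_congr hae]
    exact jumpControl_bound hU.rightContinuous hV' hA' hT hp hq hα hlam hfin hΓ
  · obtain ⟨V', hA', hV', hae⟩ := exists_cadlag_modification hU hA hc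
    have hiff := pVar_rho_lt_top_iff (P := P) hU.rightContinuous hV' hA' hT hp hq
    rw [← rho_congr hae 𝓕, ← condNorm_congr hae q 𝓕, ← GamNorm_congr hae] at hiff
    exact ⟨fun h => ⟨⟨hc, hL, (hiff.1 h.finite).1⟩, (hiff.1 h.finite).2⟩,
      fun h => ⟨hA, hc, hiff.2 ⟨h.1.finite, h.2⟩⟩⟩
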